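/- For $\xi\in\mathbb R$, $\beta>0$ let $P_{(\xi,\beta)}$ be the generalized Pareto distribution with location $0$, i.e. with density $\beta^{-1}(1+\xi x/\beta)^{-1/\xi-1}$ for $x\ge 0$ if $\xi\geq 0$ and for $0<x\le-\beta/\xi$ if $\xi<0$ (for $\xi=0$: the limit $\beta^{-1}e^{-x/\beta}$, $x\ge0$), and with scores $$\Lambda_{(\xi,\beta)}(x)=\Bigl(\tfrac1{\xi^2}\log(1+\xi z)-\tfrac{\xi+1}{\xi}\tfrac{z}{1+\xi z},\ -\tfrac1\beta+\tfrac{\xi+1}{\beta}\tfrac{z}{1+\xi z}\Bigr)^\tau,\qquad z=x/\beta$$ (for $\xi=0$ the first component is the limit $z^2/2-z$). The log-scale model has parameter $\tilde\theta=(\xi,\tilde\beta)$, $\tilde\beta=\log\beta$, the distributions $P_{(\xi,e^{\tilde\beta})}$ and the scores $\tilde\Lambda_{\tilde\theta}$, the gradient of the log-density with respect to $(\xi,\tilde\beta)$. Let $d_\beta=\mathrm{diag}(1,\beta)$ and $n_\beta(v)=|d_\beta^{-1}v|$, with $|\cdot|$ the Euclidean norm. In a model with distribution $P$ and scores $\Lambda$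 at the true parameter, $\Psi_2$ denotes the set of influence functions, i.e. of $\psi:\mathbb R\to\mathbb R^2$ with $\psi\in L_2(P)$, $\mathrm E\psi=0$, $\mathrm E\psi\Lambda^\tau=\mathbb I_2$. For a norm $n=n_s$ ($s>0$) and a radius $r>0$ put $\mathrm{GES}(\psi)=\sup_{x}n(\psi(x))$, $\mathrm{asBias}(\psi)=r\,\mathrm{GES}(\psi)$ and $\mathrm{asMSE}(\psi)=r^2\,\mathrm{GES}(\psi)^2+\mathrm{tr}\bigl(d_s^{-2}\,\mathrm E\psi\psi^\tau\bigr)$, where the last term is $\mathrm E\,n(\psi)^2$. An MBRE (resp. OMSE) influence function is a minimizer of asBias (resp. asMSE) over $\Psi_2$. For $A\in\mathbb R^{2\times2}$, $a\in\mathbb R^2$ write $Y=A\Lambda-a$. With $b>0$, the triple $(A,a,b)$ is called a system of Lagrange multipliers * for the MBRE if $bY/n(Y)\in\Psi_2$ and $b=\max_{A',a'}\mathrm{tr}(d_s^{-2}A')/\mathrm E\,n(A'\Lambda-a')$, where the maximum is over all $A',a'$ with non-vanishing denominator and is attained at $(A,a)$; * for the OMSE if $Y\min\{1,b/n(Y)\}\in\Psi_2$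 and $r^2b=\mathrm E\,(n(Y)-b)_+$. **Proposition 3.3.** Let $\xi>-\tfrac12$, $\beta>0$, $r>0$, $\theta=(\xi,\beta)$, $\theta_1=(\xi,1)$, $\tilde\theta=(\xi,\log\beta)$, $\tilde\theta_0=(\xi,0)$. Equalities between influence functions are meant $P_\theta$-almost everywhere. (a) In the original model at $\theta$ with norm $n_\beta$, an MBRE influence function $\bar\psi$ and an OMSE influence function $\hat\psi$ exist, and each is unique. They are necessarily of the form $$\bar\psi=b\,Y/n_\beta(Y)\qquad\text{resp.}\qquad\hat\psi=Y\min\{1,b/n_\beta(Y)\}$$ with Lagrange multipliers $(A,a,b)$ for the MBRE resp. the OMSE. Conversely, for any Lagrange multipliers these functions are optimal. (b) In the original model at $\theta$ with norm $n_\beta$, and at $\theta_1$ with norm $n_1$: for $\psi=\bar\psi$ and for $\psi=\hat\psi$, $\psi_\theta(x)=d_\beta\psi_{\theta_1}(x/\beta)$. The Lagrange multipliers translate according to $A_\theta=d_\beta A_{\theta_1}d_\beta$, $a_\theta=d_\beta a_{\theta_1}$, $b_\theta=b_{\theta_1}$; that is, $(A_1,a_1,b_1)$ are Lagrange multipliers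 at $\theta_1$ if and only if $(d_\beta A_1d_\beta,\,d_\beta a_1,\,b_1)$ are Lagrange multipliers at $\theta$, and any Lagrange multipliers at $\theta$ and at $\theta_1$ have the same $b$. (c) In the log-scale model at $\tilde\theta$ with the Euclidean norm, the optimal influence functions $\eta_{\tilde\theta}$ (MBRE and OMSE) likewise exist, are unique, and are exactly those of the forms in (a) (with $\tilde\Lambda_{\tilde\theta}$ and $n_1$ in place of $\Lambda_\theta$ and $n_\beta$). The Lagrange multipliers at $\tilde\theta$ are the same as those at $\tilde\theta_0$, and $\eta_{\tilde\theta}(x)=\eta_{\tilde\theta_0}(x/\beta)$. (d) The optimal influence functions in the log-scale model from (c) and in the original model from (b) are related by $\eta_{\tilde\theta}(x)=d_\beta^{-1}\psi_\theta(x)$, and their Lagrange multipliers by $\tilde A=d_\beta^{-1}A_\theta d_\beta^{-1}$, $\tilde a=d_\beta^{-1}a_\theta$, $\tilde b=b_\theta$; that is, $(A,a,b)$ are Lagrange multipliers at $\theta$ if and only if $(d_\beta^{-1}Ad_\beta^{-1},d_\beta^{-1}a,b)$ are Lagrange multipliers at $\tilde\theta$. -/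

import Mathlib

open MeasureTheory Matrix
open scoped ENNReal

noncomputable section

namespace GPD

/-- Real 2-vectors; the only norms used on them are the weighted Euclidean norms `nrm` below. -/
abbrev Vec : Type := Fin 2 → ℝ

/-- Real 2×2 matrices. -/
abbrev Mat : Type := Matrix (Fin 2) (Fin 2) ℝ

/-! The model: generalized Pareto distributions with location 0, shape `ξ` and scale `β`. -/

/-- Support of the density: `[0, ∞)` for `ξ ≥ 0`, and `(0, -β/ξ]` for `ξ < 0`. -/
def supp (ξ β : ℝ) : Set ℝ :=
  if ξ < 0 then Set.Ioc 0 (-β / ξ) else Set.Ici 0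

open Classical in
/-- The density `β⁻¹ (1 + ξ x / β) ^ (-1/ξ - 1)` on the support, which for `ξ = 0` is read as its
limit `β⁻¹ exp (-x / β)`, the exponential density. -/
def density (ξ β x : ℝ) : ℝ :=
  if x ∈ supp ξ β then
    if ξ = 0 then β⁻¹ * Real.exp (-(x / β))
    else β⁻¹ * (1 + ξ * (x / β)) ^ (-1 / ξ - 1)
  else 0

/-- The generalized Pareto distribution with shape `ξ` and scale `β`. -/
def gpd (ξ β : ℝ) : Measure ℝ :=
  volume.withDensity fun x => ENNReal.ofReal (density ξ β x)

/-- The scores of the model in the parameter `(ξ, β)`. For `ξ = 0` the first component is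
the limit `z ^ 2 / 2 - z` of the general expression, with `z = x / β`. -/
def score (ξ β : ℝ) (x : ℝ) : Vec :=
  let z := x / β
  ![if ξ = 0 then z ^ 2 / 2 - z
    else 1 / ξ ^ 2 * Real.log (1 + ξ * z) - (ξ + 1) / ξ * (z / (1 + ξ * z)),
    -(1 / β) + (ξ + 1) / β * (z / (1 + ξ * z))]

/-- The distribution with log-scale parameter `(ξ, t)`, that is, with scale `exp t`. -/
def gpdLog (ξ t : ℝ) : Measure ℝ := gpd ξ (Real.exp t)

/-- The scores of the log-scale model: the partial derivatives of the log density with respect to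
the shape `ξ` and the log-scale `t`. -/
def scoreLog (ξ t : ℝ) (x : ℝ) : Vec :=
  ![deriv (fun s => Real.log (density s (Real.exp t) x)) ξ,
    deriv (fun u => Real.log (density ξ (Real.exp u) x)) t]

/-! Norms. -/

/-- `d_β = diag (1, β)`. -/
def dMat (β : ℝ) : Mat := Matrix.diagonal ![1, β]

/-- The norm `n_β v = |d_β⁻¹ v|`, with `|·|` the Euclidean norm; `n_1` is the Euclidean norm. -/
def nrm (β : ℝ) (v : Vec) : ℝ := ‖WithLp.toLp 2 ((dMat β)⁻¹ *ᵥ v)‖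

/-! Influence functions and their robustness criteria. Here `P` is the ideal distribution, `L` the
score function of the model at the true parameter and `n_s` the norm in use. -/

/-- `ψ` is an influence function: square integrable with `E ψ = 0` and `E ψ Lᵀ = 1`. -/
structure IsIF (P : Measure ℝ) (L : ℝ → Vec) (ψ : ℝ → Vec) : Prop where
  memLp : ∀ i, MemLp (fun x => ψ x i) 2 P
  centered : ∀ i, ∫ x, ψ x i ∂P = 0
  fisher : ∀ i j, ∫ x, ψ x i * L x j ∂P = (1 : Mat) i j

/-- Gross error sensitivity `sup_x n_s (ψ x)`. -/
def GES (s : ℝ) (ψ : ℝ → Vec) : ℝ≥0∞ := ⨆ x, ENNReal.ofReal (nrm s (ψ x))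

/-- Asymptotic covariance `∫ ψ ψᵀ dP`. -/
def asVar (P : Measure ℝ) (ψ : ℝ → Vec) : Mat := Matrix.of fun i j => ∫ x, ψ x i * ψ x j ∂P

/-- Maximal asymptotic bias on shrinking gross error neighborhoods of radius `r`. -/
def asBias (s r : ℝ) (ψ : ℝ → Vec) : ℝ≥0∞ := ENNReal.ofReal r * GES s ψ

/-- Maximal asymptotic mean squared error, measured in the norm `n_s`, on shrinking gross error
neighborhoods of radius `r`. The trace is `∫ n_s (ψ) ^ 2 dP`, and is `tr asVar` for `s = 1`. -/
def asMSE (P : Measure ℝ) (s r : ℝ) (ψ : ℝ → Vec) : ℝ≥0∞ :=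
  ENNReal.ofReal (r ^ 2) * GES s ψ ^ 2 +
    ENNReal.ofReal (((dMat s)⁻¹ ^ 2 * asVar P ψ).trace)

/-- `ψ` is an influence function of minimal `asBias`. -/
def IsMBRE (P : Measure ℝ) (L : ℝ → Vec) (s r : ℝ) (ψ : ℝ → Vec) : Prop :=
  IsIF P L ψ ∧ ∀ φ, IsIF P L φ → asBias s r ψ ≤ asBias s r φ

/-- `ψ` is an influence function of minimal `asMSE`. -/
def IsOMSE (P : Measure ℝ) (L : ℝ → Vec) (s r : ℝ) (ψ : ℝ → Vec) : Prop :=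
  IsIF P L ψ ∧ ∀ φ, IsIF P L φ → asMSE P s r ψ ≤ asMSE P s r φ

/-! The clipped forms and their Lagrange multipliers. -/

/-- `Y = A L - a`. -/
def Y (L : ℝ → Vec) (A : Mat) (a : Vec) (x : ℝ) : Vec := A *ᵥ L x - a

/-- `b Y / n_s (Y)`. -/
def mbreForm (L : ℝ → Vec) (s : ℝ) (A : Mat) (a : Vec) (b : ℝ) (x : ℝ) : Vec :=
  (b / nrm s (Y L A a x)) • Y L A a x

/-- `Y min {1, b / n_s (Y)}`. -/
def omseForm (L : ℝ → Vec) (s : ℝ) (A : Mat) (a : Vec) (b : ℝ) (x : ℝ) : Vec :=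
  min 1 (b / nrm s (Y L A a x)) • Y L A a x

/-- The ratio `tr (d_s⁻² A) / E n_s (Y)`. -/
def biasRatio (P : Measure ℝ) (L : ℝ → Vec) (s : ℝ) (A : Mat) (a : Vec) : ℝ :=
  ((dMat s)⁻¹ ^ 2 * A).trace / ∫ x, nrm s (Y L A a x) ∂P

/-- `A, a, b` are Lagrange multipliers for the MBRE: `b > 0` is the maximum of `biasRatio` over all
`A', a'` for which the denominator does not vanish, this maximum is attained at `A, a`, and
`b Y / n_s (Y)` is an influence function. -/
structure IsMBREMult (P : Measure ℝ) (L : ℝ → Vec) (s : ℝ) (A : Mat) (a : Vec) (b : ℝ) :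
    Prop where
  pos : 0 < b
  attained : b = biasRatio P L s A a
  max : ∀ (A' : Mat) (a' : Vec), 0 < ∫ x, nrm s (Y L A' a' x) ∂P → biasRatio P L s A' a' ≤ b
  isIF : IsIF P L (mbreForm L s A a b)

/-- `A, a, b` are Lagrange multipliers for the OMSE of radius `r`: `b > 0`,
`r² b = E (n_s (Y) - b)₊`, and `Y min {1, b / n_s (Y)}` is an influence function. -/
structure IsOMSEMult (P : Measure ℝ) (L : ℝ → Vec) (s r : ℝ) (A : Mat) (a : Vec) (b : ℝ) :
    Prop where
  pos : 0 < b
  clip : r ^ 2 * b = ∫ x, max (nrm s (Y L A a x) - b) 0 ∂P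
  isIF : IsIF P L (omseForm L s A a b)

/-- The optimal functions (those with `IsOpt`) exist, are unique up to `P`-null sets, and are
precisely those of the given form: every one agrees almost everywhere with `form A a b` for some
multipliers `A, a, b`, and all multipliers yield an optimal function. -/
structure UniqueOfForm (P : Measure ℝ) (IsOpt : (ℝ → Vec) → Prop)
    (IsMult : Mat → Vec → ℝ → Prop) (form : Mat → Vec → ℝ → ℝ → Vec) : Prop where
  exists_opt : ∃ ψ, IsOpt ψ
  unique : ∀ ψ φ, IsOpt ψ → IsOpt φ → ψ =ᵐ[P] φ
  necessary : ∀ ψ, IsOpt ψ → ∃ A a b, IsMult A a b ∧ ψ =ᵐ[P] form A a b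
  sufficient : ∀ A a b, IsMult A a b → IsOpt (form A a b)

end GPD

end

/-! For `v = (A, a)` put `y_v = d_s⁻¹(AΛ - a)`, which is linear in `v`. A bounded measurable `ψ` is
an influence function exactly when `E⟨d_s⁻¹ψ, y_v⟩ = ℓ(v) := tr(d_s⁻²A)` for all `v`. Both problems
thus minimize a convex criterion under finitely many linear constraints, and `v` is the dual
variable.

Multipliers exist by duality. Take `F(v) = (E|y_v|)²` for the MBRE and `F(v) = E|ψ_v|² + r²b_v²` for
the OMSE, where `b_v` solves the clipping equation and `ψ_v` is the candidate form built from `y_v`.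
Half of `F` has the subgradient `z ↦ E⟨ψ_v, y_z⟩`, and `F` grows quadratically because `v ↦ y_v` is
injective into `L¹`. Hence `F - 2ℓ` has a minimizer, where the subgradient equals `ℓ`; this says
that `ψ_v` satisfies the constraints (`exists_subgradient_eq`, `exists_toSphere_multiplier`,
`exists_clipBall_multiplier`).

Optimality and uniqueness: for the MBRE, `ℓ(v) ≤ GES(φ) E|y_v|` with the equality case of
Cauchy-Schwarz (`IsIF.trace_le`, `IsMBREMult.ae_eq`); for the OMSE, the variational inequality of
the projection onto a ball integrates to a quadratic gap between risks (`IsOMSEMult.risk_add_le`).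

All this needs only integrable scores of which no nontrivial affine combination vanishes on a set of
positive probability (`Regular`). Here such a combination is constant or has a derivative with at
most one zero, so its zeros are countable.

Scaling `x ↦ βx` and passing to `log β` are both instances of `Transfer`, which carries influence
functions, criteria and multipliers from one model to the other; uniqueness then identifies the
optimal functions. -/

open Filter Topology

/-! ### Minimization by subgradients -/

/-- A function on a finite dimensional space with (half) subgradients `G`, growing at least
quadratically, has every linear functional among its subgradients. -/
theorem exists_subgradient_eq {V : Type*} [NormedAddCommGroup V] [NormedSpace ℝ V]
    [FiniteDimensional ℝ V] (F : V → ℝ) (G : V → V →ₗ[ℝ] ℝ) (ℓ : V →ₗ[ℝ] ℝ) {c : ℝ} (hc : 0 < c)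
    (hF : ∀ v, c * ‖v‖ ^ 2 ≤ F v) (hsub : ∀ v w, F w + 2 * G w (v - w) ≤ F v)
    (hlim : ∀ v z, Tendsto (fun t : ℝ => G (v + t • z) z) (𝓝[>] 0) (𝓝 (G v z))) :
    ∃ v, G v = ℓ := by
  -- At every `v` the subgradient provides a continuous affine minorant that touches `F` there.
  have hlsc : LowerSemicontinuous F := by
    intro v y hy
    have hcont : Continuous fun w => F v + 2 * G v (w - v) := by
      have := (G v).continuous_of_finiteDimensional
      fun_prop
    have : ∀ᶠ w in 𝓝 v, y < F v + 2 * G v (w - v) :=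
      hcont.continuousAt.eventually (lt_mem_nhds (by simpa using hy))
    filter_upwards [this] with w hw
    exact hw.trans_le (hsub w v)
  let ℓc : V →L[ℝ] ℝ := LinearMap.toContinuousLinearMap ℓ
  have hℓ : ∀ v, ℓ v ≤ ‖ℓc‖ * ‖v‖ := fun v =>
    (le_abs_self _).trans (ℓc.le_opNorm v)
  have hF0 : 0 ≤ F 0 := by simpa using hF 0
  obtain ⟨v, hv⟩ : ∃ v, ∀ w, F v - 2 * ℓ v ≤ F w - 2 * ℓ w := by
    -- Outside this ball `‖w‖ ≥ 1` and `c‖w‖ ≥ 2‖ℓ‖ + F 0 + 1`, so `F w - 2 ℓ w ≥ ‖w‖ (c‖w‖ - 2‖ℓ‖)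
    -- > F 0`, the value at the origin; the minimum over the ball is therefore global.
    set R : ℝ := (2 * ‖ℓc‖ + F 0 + 1) / c + 1 with hR
    have hR0 : 0 ≤ R := by positivity
    have hlsc' : LowerSemicontinuous fun w => F w - 2 * ℓ w := by
      have : Continuous fun w => -(2 * ℓ w) := by
        have := ℓ.continuous_of_finiteDimensional
        fun_prop
      simpa [sub_eq_add_neg] using hlsc.add this.lowerSemicontinuous
    obtain ⟨v, hvR, hv⟩ := (hlsc'.lowerSemicontinuousOn _).exists_isMinOn
      (s := Metric.closedBall (0 : V) R) ⟨0, by simpa using hR0⟩ (isCompact_closedBall _ _)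
    refine ⟨v, fun w => ?_⟩
    by_cases hw : w ∈ Metric.closedBall (0 : V) R
    · exact hv hw
    · have h0 := hv (show (0 : V) ∈ Metric.closedBall (0 : V) R by simpa using hR0)
      simp only [Set.mem_ofPred_eq, map_zero, mul_zero, sub_zero] at h0
      refine h0.trans ?_
      have hw' : R < ‖w‖ := by simpa using hw
      have h1 := hF w
      have h2 := hℓ w
      have h3 : 2 * ‖ℓc‖ + F 0 + 1 ≤ c * ‖w‖ := by
        have : (2 * ‖ℓc‖ + F 0 + 1) / c ≤ ‖w‖ := by linarith
        rwa [div_le_iff₀' hc] at this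
      have h4 : 1 ≤ ‖w‖ := by
        have : 0 ≤ (2 * ‖ℓc‖ + F 0 + 1) / c := by positivity
        linarith
      nlinarith [norm_nonneg ℓc]
  -- The subgradient is taken at the displaced point `v + t z`, where it bounds the increment of `F`
  -- from above; minimality bounds the increment from below by `2 t ℓ z`. Then `t ↓ 0`.
  have key : ∀ z, ℓ z ≤ G v z := by
    intro z
    refine ge_of_tendsto (hlim v z) ?_
    filter_upwards [self_mem_nhdsWithin] with t ht
    have h1 := hv (v + t • z)
    have h2 := hsub v (v + t • z)
    simp only [map_add, map_smul, smul_eq_mul, sub_add_cancel_left, map_neg] at h1 h2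
    have : t * ℓ z ≤ t * G (v + t • z) z := by linarith
    exact le_of_mul_le_mul_left this ht
  refine ⟨v, LinearMap.ext fun z => le_antisymm ?_ (key z)⟩
  have := key (-z)
  simp only [map_neg] at this
  linarith

/-! ### Radial projections onto spheres and balls -/

section Clipping

variable {H : Type*} [NormedAddCommGroup H] [InnerProductSpace ℝ H]

/-- Radial projection onto the ball of radius `b`. -/
noncomputable def clipBall (b : ℝ) (y : H) : H := min 1 (b / ‖y‖) • y

/-- Radial projection onto the sphere of radius `b`. -/
noncomputable def toSphere (b : ℝ) (y : H) : H := (b / ‖y‖) • y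

theorem norm_toSphere_le {b : ℝ} (hb : 0 ≤ b) (y : H) : ‖toSphere b y‖ ≤ b := by
  rw [toSphere, norm_smul, Real.norm_of_nonneg (by positivity)]
  rcases eq_or_ne y 0 with rfl | hy
  · simpa using hb
  · rw [div_mul_cancel₀ _ (norm_ne_zero_iff.2 hy)]

theorem norm_clipBall {b : ℝ} (hb : 0 ≤ b) (y : H) : ‖clipBall b y‖ = min ‖y‖ b := by
  rw [clipBall, norm_smul, Real.norm_of_nonneg (by positivity)]
  rcases eq_or_ne y 0 with rfl | hy
  · simp [hb]
  · have : 0 < ‖y‖ := norm_pos_iff.2 hy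
    rw [min_mul_of_nonneg _ _ this.le, one_mul, div_mul_cancel₀ _ this.ne']

theorem norm_clipBall_le {b : ℝ} (hb : 0 ≤ b) (y : H) : ‖clipBall b y‖ ≤ b :=
  (norm_clipBall hb y).trans_le (min_le_right _ _)

theorem inner_toSphere_self (b : ℝ) (y : H) : inner ℝ (toSphere b y) y = b * ‖y‖ := by
  rw [toSphere, real_inner_smul_left, real_inner_self_eq_norm_sq]
  rcases eq_or_ne y 0 with rfl | hy
  · simp
  · field_simp [norm_ne_zero_iff.2 hy]

theorem sub_clipBall (b : ℝ) (y : H) :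
    y - clipBall b y = (max (‖y‖ - b) 0 / ‖y‖) • y := by
  rcases eq_or_ne y 0 with rfl | hy
  · simp [clipBall]
  have hy' : 0 < ‖y‖ := norm_pos_iff.2 hy
  nth_rw 1 [clipBall, ← one_smul ℝ y]
  rw [← sub_smul]
  congr 1
  rcases le_total ‖y‖ b with h | h
  · rw [max_eq_right (by linarith), min_eq_left ((one_le_div hy').2 h)]; simp
  · rw [max_eq_left (by linarith), min_eq_right ((div_le_one hy').2 h)]
    field_simp

theorem norm_sub_clipBall {b : ℝ} (hb : 0 ≤ b) (y : H) :
    ‖y - clipBall b y‖ = max (‖y‖ - b) 0 := by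
  rw [sub_clipBall b, norm_smul, Real.norm_of_nonneg (by positivity)]
  rcases eq_or_ne y 0 with rfl | hy
  · simp [hb]
  · rw [div_mul_cancel₀ _ (norm_ne_zero_iff.2 hy)]

/-- The residual points in the direction of `y` and vanishes unless the projection has norm `b`. -/
theorem inner_clipBall_sub {b : ℝ} (hb : 0 ≤ b) (y : H) :
    inner ℝ (clipBall b y) (y - clipBall b y) = b * max (‖y‖ - b) 0 := by
  rw [sub_clipBall b, clipBall, real_inner_smul_left, real_inner_smul_right,
    real_inner_self_eq_norm_sq]
  rcases eq_or_ne y 0 with rfl | hy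
  · simp [hb]
  have hy' : 0 < ‖y‖ := norm_pos_iff.2 hy
  rcases le_total ‖y‖ b with h | h
  · rw [max_eq_right (by linarith)]; simp
  · rw [max_eq_left (by linarith), min_eq_right ((div_le_one hy').2 h)]
    field_simp

/-- The variational inequality of the projection onto a ball, for test points in a larger or
smaller ball. -/
theorem inner_sub_clipBall_le {b c : ℝ} (hb : 0 ≤ b) {φ : H} (hφ : ‖φ‖ ≤ c) (y : H) :
    inner ℝ (φ - clipBall b y) (y - clipBall b y) ≤ (c - b) * max (‖y‖ - b) 0 := by
  rw [inner_sub_left, inner_clipBall_sub hb]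
  have := real_inner_le_norm φ (y - clipBall b y)
  rw [norm_sub_clipBall hb] at this
  have h2 : ‖φ‖ * max (‖y‖ - b) 0 ≤ c * max (‖y‖ - b) 0 := by gcongr
  linarith

theorem tendsto_toSphere {α : Type*} {l : Filter α} {f : α → ℝ} {g : α → H} {b : ℝ} {y : H}
    (hf : Tendsto f l (𝓝 b)) (hg : Tendsto g l (𝓝 y)) (hy : y ≠ 0) :
    Tendsto (fun t => toSphere (f t) (g t)) l (𝓝 (toSphere b y)) :=
  (hf.div hg.norm (norm_ne_zero_iff.2 hy)).smul hg

/-- Unlike `toSphere`, clipping is continuous at the origin too, because it does not increase norms.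
-/
theorem tendsto_clipBall {α : Type*} {l : Filter α} {f : α → ℝ} {g : α → H} {b : ℝ} {y : H}
    (hf : Tendsto f l (𝓝 b)) (hf0 : ∀ t, 0 ≤ f t) (hg : Tendsto g l (𝓝 y)) :
    Tendsto (fun t => clipBall (f t) (g t)) l (𝓝 (clipBall b y)) := by
  rcases eq_or_ne y 0 with rfl | hy
  · simp only [clipBall, smul_zero]
    refine squeeze_zero_norm (fun t => ?_) (by simpa using hg.norm)
    exact (norm_clipBall (hf0 t) (g t)).trans_le (min_le_left _ _)
  · exact (tendsto_const_nhds.min (hf.div hg.norm (norm_ne_zero_iff.2 hy))).smul hg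

end Clipping

/-! ### Dual problems for a finite dimensional family of integrable functions -/

section LinearFamily

variable {Ω H V : Type*} [MeasurableSpace Ω] {μ : Measure Ω}
  [NormedAddCommGroup H] [InnerProductSpace ℝ H]
  [NormedAddCommGroup V] [NormedSpace ℝ V]

/-- Dominated integrability of `⟪φ, f⟫` for bounded `φ`. -/
theorem integrable_inner_of_bound {φ f : Ω → H} (hφ : AEStronglyMeasurable φ μ) {b : ℝ}
    (hb : ∀ᵐ x ∂μ, ‖φ x‖ ≤ b) (hf : Integrable f μ) :
    Integrable (fun x => inner ℝ (φ x) (f x)) μ := by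
  refine (hf.norm.const_mul b).mono' (hφ.inner hf.1) ?_
  filter_upwards [hb] with x hx
  exact (norm_inner_le_norm _ _).trans (by gcongr)

theorem aestronglyMeasurable_toSphere {f : Ω → H} (hf : AEStronglyMeasurable f μ) (b : ℝ) :
    AEStronglyMeasurable (fun x => toSphere b (f x)) μ :=
  ((aemeasurable_const.div hf.norm.aemeasurable).aestronglyMeasurable).smul hf

theorem aestronglyMeasurable_clipBall {f : Ω → H} (hf : AEStronglyMeasurable f μ) (b : ℝ) :
    AEStronglyMeasurable (fun x => clipBall b (f x)) μ :=
  ((aemeasurable_const.min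
    (aemeasurable_const.div hf.norm.aemeasurable)).aestronglyMeasurable).smul hf

theorem integrable_clip [IsFiniteMeasure μ] {f : Ω → ℝ} (hf : Integrable f μ) (b : ℝ) :
    Integrable (fun x => max (f x - b) 0) μ :=
  (hf.sub (integrable_const b)).pos_part

/-- The clipping equation `r² b = ∫ (f - b)₊` has a nonnegative solution. -/
theorem exists_clip_eq [IsFiniteMeasure μ] {f : Ω → ℝ} (hf : Integrable f μ)
    (hf0 : ∀ x, 0 ≤ f x) {r : ℝ} (hr : 0 < r) :
    ∃ b, 0 ≤ b ∧ r ^ 2 * b = ∫ x, max (f x - b) 0 ∂μ := by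
  have hcont : Continuous fun b => r ^ 2 * b - ∫ x, max (f x - b) 0 ∂μ := by
    refine (continuous_const.mul continuous_id).sub ?_
    rw [continuous_iff_continuousAt]
    intro b
    refine continuousAt_of_dominated (bound := fun x => f x + (|b| + 1))
      (Eventually.of_forall fun c => (integrable_clip hf c).1) ?_
      (hf.add (integrable_const _)) (ae_of_all _ fun x => by fun_prop)
    filter_upwards [Metric.ball_mem_nhds b one_pos] with c hc
    refine ae_of_all _ fun x => ?_
    rw [Real.norm_of_nonneg (le_max_right _ _)]
    have h1 : |c - b| < 1 := hc
    have h2 := abs_lt.1 h1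
    have h3 := neg_abs_le b
    have := hf0 x
    exact max_le (by linarith) (by positivity)
  have hI : 0 ≤ ∫ x, f x ∂μ := integral_nonneg hf0
  -- The difference of the two sides is nonpositive at `0`, and nonnegative at this point since `(f
  -- - b)₊ ≤ f`.
  have hB : 0 ≤ (∫ x, f x ∂μ) / r ^ 2 := by positivity
  have := intermediate_value_Icc hB hcont.continuousOn
  obtain ⟨b, hb, hb'⟩ := this (show (0 : ℝ) ∈ _ from by
    constructor
    · simp only [mul_zero, zero_sub, Left.neg_nonpos_iff]
      exact integral_nonneg fun x => le_max_right _ _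
    · rw [mul_div_cancel₀ _ (by positivity), sub_nonneg]
      refine integral_mono (integrable_clip hf _) hf fun x => ?_
      exact max_le (by linarith) (hf0 x))
  exact ⟨b, hb.1, by simpa [sub_eq_zero] using hb'⟩

/-- If `c ≤ b`, then `(f - b)₊ ≤ (g - c)₊ + |f - g|`. Applied in both orders, this makes the
clipping bound Lipschitz in the `L¹` distance, and in particular unique. -/
theorem clip_solution_sub_le [IsFiniteMeasure μ] {f g : Ω → ℝ} (hf : Integrable f μ)
    (hg : Integrable g μ) {r b c : ℝ} (hb : r ^ 2 * b = ∫ x, max (f x - b) 0 ∂μ)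
    (hc : r ^ 2 * c = ∫ x, max (g x - c) 0 ∂μ) :
    r ^ 2 * (b - c) ≤ ∫ x, |f x - g x| ∂μ := by
  rcases le_total b c with h | h
  · exact (mul_nonpos_of_nonneg_of_nonpos (sq_nonneg r) (by linarith)).trans
      (integral_nonneg fun x => abs_nonneg _)
  · rw [mul_sub, hb, hc, ← integral_sub (integrable_clip hf b) (integrable_clip hg c)]
    refine integral_mono ((integrable_clip hf b).sub (integrable_clip hg c)) (hf.sub hg).abs
      fun x => ?_
    simp only
    have h1 := le_abs_self (f x - g x)
    have h2 := le_max_left (g x - c) 0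
    have h3 := le_max_right (g x - c) 0
    have h4 := abs_nonneg (f x - g x)
    have : max (f x - b) 0 ≤ max (g x - c) 0 + |f x - g x| := max_le (by linarith) (by linarith)
    linarith

/-- Integrates `f ≤ (f - b)₊ + b`. It lets the bound inherit the growth of the `L¹` norm. -/
theorem integral_le_of_clip_eq [IsFiniteMeasure μ] {f : Ω → ℝ} (hf : Integrable f μ)
    {r b : ℝ} (hb : r ^ 2 * b = ∫ x, max (f x - b) 0 ∂μ) :
    ∫ x, f x ∂μ ≤ (r ^ 2 + μ.real Set.univ) * b := by
  have : ∫ x, f x ∂μ ≤ ∫ x, (max (f x - b) 0 + b) ∂μ :=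
    integral_mono hf ((integrable_clip hf b).add (integrable_const b)) fun x => by
      have := le_max_left (f x - b) 0
      simp only
      linarith
  rw [integral_add (integrable_clip hf b) (integrable_const b), ← hb] at this
  simp only [integral_const, smul_eq_mul] at this
  linarith

/-- On a finite dimensional family of integrable functions, injectively parametrized, the `L¹` norm
dominates the norm of the parameter. -/
theorem exists_pos_mul_norm_le_integral [FiniteDimensional ℝ V] (y : V →ₗ[ℝ] Ω → H)
    (hy : ∀ v, Integrable (y v) μ) (hinj : ∀ v, y v =ᵐ[μ] 0 → v = 0) :
    ∃ c, 0 < c ∧ ∀ v, c * ‖v‖ ≤ ∫ x, ‖y v x‖ ∂μ := by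
  -- An injective linear map from a finite dimensional space into `L¹` is bounded below.
  let T : V →ₗ[ℝ] Lp H 1 μ :=
    { toFun := fun v => (hy v).toL1
      map_add' := fun v w => by
        rw [← Integrable.toL1_add, Integrable.toL1_eq_toL1_iff]
        exact Eventually.of_forall fun x => by simp
      map_smul' := fun a v => by
        rw [RingHom.id_apply, ← Integrable.toL1_smul, Integrable.toL1_eq_toL1_iff]
        exact Eventually.of_forall fun x => by simp }
  have hT : LinearMap.ker T = ⊥ := by
    rw [LinearMap.ker_eq_bot']
    intro v hv
    refine hinj v ?_
    have : (hy v).toL1 = (integrable_zero Ω H μ).toL1 := by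
      rw [Integrable.toL1_zero]; exact hv
    rwa [Integrable.toL1_eq_toL1_iff] at this
  obtain ⟨K, hK, hTK⟩ := T.exists_antilipschitzWith hT
  refine ⟨(K : ℝ)⁻¹, by positivity, fun v => ?_⟩
  have h1 := hTK.le_mul_dist v 0
  have h2 : ‖T v‖ = ∫ x, ‖y v x‖ ∂μ := L1.norm_of_fun_eq_integral_norm (hy v)
  rw [map_zero, dist_zero_right, dist_zero_right, h2] at h1
  rwa [inv_mul_le_iff₀ (by positivity)]

theorem abs_integral_norm_sub_le (y : V →ₗ[ℝ] Ω → H) (hy : ∀ v, Integrable (y v) μ) (v z : V)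
    (t : ℝ) : ∫ x, |‖y (v + t • z) x‖ - ‖y v x‖| ∂μ ≤ |t| * ∫ x, ‖y z x‖ ∂μ := by
  rw [← integral_const_mul]
  refine integral_mono ((hy _).norm.sub (hy _).norm).abs ((hy z).norm.const_mul _) fun x => ?_
  simp only [map_add, map_smul, Pi.add_apply, Pi.smul_apply]
  refine (abs_norm_sub_norm_le _ _).trans_eq ?_
  rw [add_sub_cancel_left, norm_smul, Real.norm_eq_abs]

theorem tendsto_apply_add_smul {Ω : Type*} (y : V →ₗ[ℝ] Ω → H) (v z : V) (x : Ω) :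
    Tendsto (fun t : ℝ => y (v + t • z) x) (𝓝[>] 0) (𝓝 (y v x)) := by
  have : Continuous fun t : ℝ => y v x + t • y z x := by fun_prop
  have := this.tendsto 0
  simp only [zero_smul, add_zero] at this
  simpa using this.mono_left nhdsWithin_le_nhds

/-- The functional `z ↦ ∫ ⟪φ, y z⟫` for bounded `φ`. -/
noncomputable def innerFunctional (y : V →ₗ[ℝ] Ω → H) (hy : ∀ v, Integrable (y v) μ) (φ : Ω → H)
    (hφ : AEStronglyMeasurable φ μ) {b : ℝ} (hb : ∀ x, ‖φ x‖ ≤ b) : V →ₗ[ℝ] ℝ where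
  toFun z := ∫ x, inner ℝ (φ x) (y z x) ∂μ
  map_add' z w := by
    rw [← integral_add (integrable_inner_of_bound hφ (ae_of_all _ hb) (hy z))
      (integrable_inner_of_bound hφ (ae_of_all _ hb) (hy w))]
    simp [inner_add_right]
  map_smul' a z := by
    rw [RingHom.id_apply, smul_eq_mul, ← integral_const_mul]
    simp [inner_smul_right]

/-- Dominated convergence; this is the one-sided continuity of the subgradients asked for by
`exists_subgradient_eq`. -/
theorem tendsto_innerFunctional (y : V →ₗ[ℝ] Ω → H) (hy : ∀ v, Integrable (y v) μ)
    (ψ : V → Ω → H) (hψ : ∀ v, AEStronglyMeasurable (ψ v) μ) {b : V → ℝ}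
    (hb : ∀ v x, ‖ψ v x‖ ≤ b v) (v z : V)
    (hbt : Tendsto (fun t : ℝ => b (v + t • z)) (𝓝[>] 0) (𝓝 (b v)))
    (hψt : ∀ᵐ x ∂μ, Tendsto (fun t : ℝ => ψ (v + t • z) x) (𝓝[>] 0) (𝓝 (ψ v x))) :
    Tendsto (fun t : ℝ => innerFunctional y hy (ψ (v + t • z)) (hψ _) (hb _) z) (𝓝[>] 0)
      (𝓝 (innerFunctional y hy (ψ v) (hψ v) (hb v) z)) := by
  refine tendsto_integral_filter_of_dominated_convergence (fun x => (b v + 1) * ‖y z x‖)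
    (Eventually.of_forall fun t => (hψ _).inner (hy z).1) ?_ ((hy z).norm.const_mul _) ?_
  · filter_upwards [hbt.eventually (gt_mem_nhds (lt_add_one (b v)))] with t ht
    refine ae_of_all _ fun x => (norm_inner_le_norm _ _).trans ?_
    have := hb (v + t • z) x
    gcongr
    linarith
  · filter_upwards [hψt] with x hx
    exact hx.inner tendsto_const_nhds

/-- Existence of multipliers in the problem of minimal supremum norm. -/
theorem exists_toSphere_multiplier [FiniteDimensional ℝ V] (y : V →ₗ[ℝ] Ω → H)
    (hy : ∀ v, Integrable (y v) μ) (hinj : ∀ v, y v =ᵐ[μ] 0 → v = 0)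
    (hne : ∀ v, v ≠ 0 → ∀ᵐ x ∂μ, y v x ≠ 0) (ℓ : V →ₗ[ℝ] ℝ) (hℓ : ℓ ≠ 0) :
    ∃ v, 0 < ∫ x, ‖y v x‖ ∂μ ∧
      ∀ z, ∫ w, inner ℝ (toSphere (∫ x, ‖y v x‖ ∂μ) (y v w)) (y z w) ∂μ = ℓ z := by
  set M : V → ℝ := fun v => ∫ x, ‖y v x‖ ∂μ with hM
  have hM0 : ∀ v, 0 ≤ M v := fun v => integral_nonneg fun x => norm_nonneg _
  have hmeas : ∀ v, AEStronglyMeasurable (fun x => toSphere (M v) (y v x)) μ :=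
    fun v => aestronglyMeasurable_toSphere (hy v).1 _
  have hbd : ∀ v x, ‖toSphere (M v) (y v x)‖ ≤ M v := fun v x => norm_toSphere_le (hM0 v) _
  have hMt : ∀ v z, Tendsto (fun t : ℝ => M (v + t • z)) (𝓝[>] 0) (𝓝 (M v)) := by
    intro v z
    rw [tendsto_iff_dist_tendsto_zero]
    refine squeeze_zero (g := fun t => |t| * M z) (fun t => dist_nonneg) (fun t => ?_) ?_
    · refine le_trans ?_ (abs_integral_norm_sub_le y hy v z t)
      rw [Real.dist_eq, ← integral_sub (hy _).norm (hy _).norm]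
      exact abs_integral_le_integral_abs
    · have : Continuous fun t : ℝ => |t| * M z := by fun_prop
      simpa using (this.tendsto 0).mono_left nhdsWithin_le_nhds
  obtain ⟨c, hc, hcM⟩ := exists_pos_mul_norm_le_integral y hy hinj
  -- Here `G w w = (M w)²` and `G w v ≤ M w * M v`, so the subgradient inequality reduces to `(M v -
  -- M w)² ≥ 0`.
  obtain ⟨v, hv⟩ := exists_subgradient_eq (fun v => M v ^ 2)
    (fun v => innerFunctional y hy (fun x => toSphere (M v) (y v x)) (hmeas v) (hbd v)) ℓ
    (c := c ^ 2) (by positivity)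
    (fun v => by rw [← mul_pow]; have := hcM v; gcongr)
    (fun v w => by
      have h1 : innerFunctional y hy (fun x => toSphere (M w) (y w x)) (hmeas w) (hbd w) w
          = M w * M w := by
        simp only [innerFunctional, LinearMap.coe_mk, AddHom.coe_mk, inner_toSphere_self]
        exact integral_const_mul _ _
      have h2 : innerFunctional y hy (fun x => toSphere (M w) (y w x)) (hmeas w) (hbd w) v
          ≤ M w * M v := by
        simp only [innerFunctional, LinearMap.coe_mk, AddHom.coe_mk]
        rw [hM, ← integral_const_mul]
        refine integral_mono (integrable_inner_of_bound (hmeas w) (ae_of_all _ (hbd w)) (hy v))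
          ((hy v).norm.const_mul _) fun x => (real_inner_le_norm _ _).trans ?_
        have := hbd w x
        gcongr
      rw [map_sub, h1]
      nlinarith [sq_nonneg (M v - M w)])
    (fun v z => by
      refine tendsto_innerFunctional y hy (fun v x => toSphere (M v) (y v x)) hmeas hbd v z
        (hMt v z) ?_
      -- `toSphere` is discontinuous at the origin. For `v = 0` the radius itself tends to zero;
      -- otherwise `y v` avoids the origin almost everywhere.
      rcases eq_or_ne v 0 with rfl | hv
      · refine ae_of_all _ fun x => ?_
        simp only [map_zero, Pi.zero_apply, toSphere, smul_zero]
        have := hMt 0 z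
        refine squeeze_zero_norm (fun t => hbd _ x) ?_
        simpa [hM] using this
      · filter_upwards [hne v hv] with x hx
        exact tendsto_toSphere (hMt v z) (tendsto_apply_add_smul y v z x) hx)
  -- A vanishing radius would make the functional, hence `ℓ`, zero.
  refine ⟨v, (hM0 v).lt_of_ne' fun h => hℓ ?_, fun z => LinearMap.congr_fun hv z⟩
  rw [← hv]
  ext z
  simp [innerFunctional, h, toSphere]

/-- Existence of multipliers in the problem of minimal weighted sum of the squared supremum norm
and the squared `L²` norm. -/
theorem exists_clipBall_multiplier [IsFiniteMeasure μ] [FiniteDimensional ℝ V]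
    (y : V →ₗ[ℝ] Ω → H)
    (hy : ∀ v, Integrable (y v) μ) (hinj : ∀ v, y v =ᵐ[μ] 0 → v = 0) (ℓ : V →ₗ[ℝ] ℝ) (hℓ : ℓ ≠ 0)
    {r : ℝ} (hr : 0 < r) :
    ∃ v b, 0 < b ∧ r ^ 2 * b = ∫ x, max (‖y v x‖ - b) 0 ∂μ ∧
      ∀ z, ∫ x, inner ℝ (clipBall b (y v x)) (y z x) ∂μ = ℓ z := by
  choose b hb0 hb using fun v => exists_clip_eq (hy v).norm (fun x => norm_nonneg _) hr
  have hmeas : ∀ v, AEStronglyMeasurable (fun x => clipBall (b v) (y v x)) μ :=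
    fun v => aestronglyMeasurable_clipBall (hy v).1 _
  have hbd : ∀ v x, ‖clipBall (b v) (y v x)‖ ≤ b v := fun v x => norm_clipBall_le (hb0 v) _
  have hsq : ∀ v, Integrable (fun x => ‖clipBall (b v) (y v x)‖ ^ 2) μ := by
    intro v
    refine (integrable_const (b v ^ 2)).mono' ((hmeas v).norm.pow 2) (ae_of_all _ fun x => ?_)
    rw [Real.norm_of_nonneg (by positivity)]
    have := hbd v x
    gcongr
  have hbt : ∀ v z, Tendsto (fun t : ℝ => b (v + t • z)) (𝓝[>] 0) (𝓝 (b v)) := by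
    intro v z
    rw [tendsto_iff_dist_tendsto_zero]
    refine squeeze_zero (g := fun t => |t| * (∫ x, ‖y z x‖ ∂μ) / r ^ 2) (fun t => dist_nonneg)
      (fun t => ?_) ?_
    · rw [le_div_iff₀' (by positivity), Real.dist_eq]
      refine le_trans ?_ (abs_integral_norm_sub_le y hy v z t)
      rcases abs_cases (b (v + t • z) - b v) with h | h <;> rw [h.1]
      · exact clip_solution_sub_le (hy _).norm (hy _).norm (hb _) (hb _)
      · rw [neg_sub]
        refine (clip_solution_sub_le (hy _).norm (hy _).norm (hb _) (hb _)).trans_eq ?_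
        simp_rw [abs_sub_comm]
    · have : Continuous fun t : ℝ => |t| * (∫ x, ‖y z x‖ ∂μ) / r ^ 2 := by fun_prop
      simpa using (this.tendsto 0).mono_left nhdsWithin_le_nhds
  obtain ⟨c, hc, hcM⟩ := exists_pos_mul_norm_le_integral y hy hinj
  set K := r ^ 2 + μ.real Set.univ with hK
  have hK0 : 0 < K := by positivity
  -- By the clipping equation `G w w = F w`. Young's inequality bounds `G w v`, and what remains of
  -- the subgradient inequality is `r² (b v - b w)² ≥ 0`.
  obtain ⟨v, hv⟩ := exists_subgradient_eq
    (fun v => ∫ x, ‖clipBall (b v) (y v x)‖ ^ 2 ∂μ + r ^ 2 * b v ^ 2)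
    (fun v => innerFunctional y hy (fun x => clipBall (b v) (y v x)) (hmeas v) (hbd v)) ℓ
    (c := r ^ 2 * (c / K) ^ 2) (by positivity)
    (fun v => by
      have h1 : c / K * ‖v‖ ≤ b v := by
        rw [div_mul_eq_mul_div, div_le_iff₀' hK0]
        exact (hcM v).trans (integral_le_of_clip_eq (hy v).norm (hb v))
      have h2 : 0 ≤ ∫ x, ‖clipBall (b v) (y v x)‖ ^ 2 ∂μ :=
        integral_nonneg fun x => by positivity
      have h3 : (c / K * ‖v‖) ^ 2 ≤ b v ^ 2 := by gcongr
      rw [mul_pow] at h3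
      nlinarith [sq_nonneg r])
    (fun v w => by
      have hin : ∀ v w, Integrable (fun x => inner ℝ (clipBall (b w) (y w x)) (y v x)) μ :=
        fun v w => integrable_inner_of_bound (hmeas w) (ae_of_all _ (hbd w)) (hy v)
      have h1 : innerFunctional y hy (fun x => clipBall (b w) (y w x)) (hmeas w) (hbd w) w
          = ∫ x, ‖clipBall (b w) (y w x)‖ ^ 2 ∂μ + r ^ 2 * b w ^ 2 := by
        have : ∀ x, inner ℝ (clipBall (b w) (y w x)) (y w x)
            = ‖clipBall (b w) (y w x)‖ ^ 2 + b w * max (‖y w x‖ - b w) 0 := by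
          intro x
          rw [← inner_clipBall_sub (hb0 w), inner_sub_right, real_inner_self_eq_norm_sq]
          ring
        simp only [innerFunctional, LinearMap.coe_mk, AddHom.coe_mk, this]
        rw [integral_add (hsq w) ((integrable_clip (hy w).norm _).const_mul _),
          integral_const_mul, ← hb]
        ring
      have h2 : innerFunctional y hy (fun x => clipBall (b w) (y w x)) (hmeas w) (hbd w) v
          ≤ ((∫ x, ‖clipBall (b w) (y w x)‖ ^ 2 ∂μ) + ∫ x, ‖clipBall (b v) (y v x)‖ ^ 2 ∂μ) / 2
            + r ^ 2 * (b w * b v) := by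
        have h3 : ∀ x, inner ℝ (clipBall (b w) (y w x)) (y v x)
            ≤ (‖clipBall (b w) (y w x)‖ ^ 2 + ‖clipBall (b v) (y v x)‖ ^ 2) / 2
              + b w * max (‖y v x‖ - b v) 0 := by
          intro x
          -- The clipped part is paired by Young's inequality; the residual is paired with a vector
          -- of norm at most `b w`, and its norm integrates to `r² b v`.
          have h4 : y v x = clipBall (b v) (y v x) + (y v x - clipBall (b v) (y v x)) := by abel
          have h5 := real_inner_le_norm (clipBall (b w) (y w x)) (clipBall (b v) (y v x))
          have h6 := real_inner_le_norm (clipBall (b w) (y w x)) (y v x - clipBall (b v) (y v x))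
          rw [norm_sub_clipBall (hb0 v)] at h6
          have h7 : ‖clipBall (b w) (y w x)‖ * max (‖y v x‖ - b v) 0
              ≤ b w * max (‖y v x‖ - b v) 0 := by
            have := hbd w x
            gcongr
          nth_rw 1 [h4]
          rw [inner_add_right]
          nlinarith [sq_nonneg (‖clipBall (b w) (y w x)‖ - ‖clipBall (b v) (y v x)‖)]
        have h4 : Integrable (fun x => (‖clipBall (b w) (y w x)‖ ^ 2
            + ‖clipBall (b v) (y v x)‖ ^ 2) / 2) μ := ((hsq w).add (hsq v)).div_const 2
        have h5 := (integrable_clip (hy v).norm (b v)).const_mul (b w)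
        refine (integral_mono (hin v w) (h4.add h5) h3).trans_eq ?_
        simp only [Pi.add_apply]
        rw [integral_add h4 h5, integral_div,
          integral_add (hsq w) (hsq v), integral_const_mul, ← hb]
        ring
      rw [map_sub, h1]
      nlinarith [sq_nonneg (r * (b v - b w))])
    (fun v z => tendsto_innerFunctional y hy (fun v x => clipBall (b v) (y v x)) hmeas hbd v z
      (hbt v z) (ae_of_all _ fun x => tendsto_clipBall (hbt v z) (fun t => hb0 _)
        (tendsto_apply_add_smul y v z x)))
  refine ⟨v, b v, (hb0 v).lt_of_ne' fun h => hℓ ?_, hb v, fun z => LinearMap.congr_fun hv z⟩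
  rw [← hv]
  ext z
  simp [innerFunctional, h, clipBall]

end LinearFamily

/-! ### Influence functions as solutions of a linear moment problem -/

noncomputable section

namespace GPD

/-- The parameter space of `Y`: matrix and centering vector. -/
abbrev Par : Type := (Fin 2 → Fin 2 → ℝ) × (Fin 2 → ℝ)

/-- The linear map `d_s⁻¹`, with values in Euclidean space. -/
def whiten (s : ℝ) : Vec →ₗ[ℝ] EuclideanSpace ℝ (Fin 2) :=
  (WithLp.linearEquiv 2 ℝ Vec).symm.toLinearMap ∘ₗ (dMat s)⁻¹.mulVecLin

theorem nrm_eq (s : ℝ) (v : Vec) : nrm s v = ‖whiten s v‖ := rfl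

theorem dMat_inv {s : ℝ} (hs : s ≠ 0) : (dMat s)⁻¹ = Matrix.diagonal ![1, s⁻¹] := by
  refine Matrix.inv_eq_left_inv ?_
  rw [dMat, Matrix.diagonal_mul_diagonal, ← Matrix.diagonal_one]
  congr 1
  ext i
  fin_cases i <;> simp [hs]

theorem whiten_apply {s : ℝ} (hs : s ≠ 0) (v : Vec) (i : Fin 2) :
    whiten s v i = ![1, s⁻¹] i * v i := by
  fin_cases i <;> simp [whiten, dMat_inv hs]

theorem inner_whiten {s : ℝ} (hs : s ≠ 0) (v w : Vec) :
    inner ℝ (whiten s v) (whiten s w) = v 0 * w 0 + (s⁻¹) ^ 2 * (v 1 * w 1) := by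
  rw [PiLp.inner_apply, Fin.sum_univ_two]
  simp only [whiten_apply hs, RCLike.inner_apply, conj_trivial]
  simp
  ring

theorem nrm_sq {s : ℝ} (hs : s ≠ 0) (v : Vec) :
    nrm s v ^ 2 = v 0 ^ 2 + (s⁻¹) ^ 2 * v 1 ^ 2 := by
  rw [nrm_eq, ← real_inner_self_eq_norm_sq, inner_whiten hs]
  ring

theorem whiten_injective {s : ℝ} (hs : s ≠ 0) : Function.Injective (whiten s) := by
  intro v w h
  ext i
  have := congr_arg (fun u : EuclideanSpace ℝ (Fin 2) => u i) h
  simp only [whiten_apply hs] at this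
  fin_cases i <;> simpa [hs] using this

theorem abs_apply_le {s : ℝ} (hs : 0 < s) (v : Vec) (i : Fin 2) :
    |v i| ≤ max 1 s * nrm s v := by
  have h := PiLp.norm_apply_le (whiten s v) i
  rw [whiten_apply hs.ne', Real.norm_eq_abs, ← nrm_eq] at h
  have h0 : 0 ≤ nrm s v := norm_nonneg _
  fin_cases i
  · simp only [Fin.zero_eta, cons_val_zero, one_mul] at h ⊢
    have := le_max_left 1 s
    nlinarith
  · simp only [Fin.mk_one, cons_val_one, cons_val_fin_one, abs_mul, abs_inv, abs_of_pos hs] at h ⊢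
    rw [inv_mul_le_iff₀ hs] at h
    exact h.trans (by gcongr; exact le_max_right _ _)

theorem trace_dMat_mul {s : ℝ} (hs : s ≠ 0) (A : Mat) :
    ((dMat s)⁻¹ ^ 2 * A).trace = A 0 0 + (s⁻¹) ^ 2 * A 1 1 := by
  rw [dMat_inv hs, Matrix.diagonal_pow, Matrix.trace_fin_two]
  simp [Matrix.diagonal_mul]

theorem continuous_whiten (s : ℝ) : Continuous (whiten s) :=
  (whiten s).continuous_of_finiteDimensional

/-- Models with integrable and nondegenerate scores. -/
structure Regular (P : Measure ℝ) (L : ℝ → Vec) : Prop where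
  finite : IsFiniteMeasure P
  ne_zero : P ≠ 0
  integrable : ∀ i, Integrable (fun x => L x i) P
  nondeg : ∀ (A : Mat) (a : Vec), A ≠ 0 ∨ a ≠ 0 → ∀ᵐ x ∂P, Y L A a x ≠ 0

variable {P : Measure ℝ} {L : ℝ → Vec} {s r : ℝ}

theorem whiten_mbreForm (A : Mat) (a : Vec) (b x : ℝ) :
    whiten s (mbreForm L s A a b x) = toSphere b (whiten s (Y L A a x)) :=
  map_smul _ _ _

theorem whiten_omseForm (A : Mat) (a : Vec) (b x : ℝ) :
    whiten s (omseForm L s A a b x) = clipBall b (whiten s (Y L A a x)) :=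
  map_smul _ _ _

theorem nrm_mbreForm_le {b : ℝ} (hb : 0 ≤ b) (A : Mat) (a : Vec) (x : ℝ) :
    nrm s (mbreForm L s A a b x) ≤ b := by
  rw [nrm_eq, whiten_mbreForm]
  exact norm_toSphere_le hb _

theorem nrm_omseForm_le {b : ℝ} (hb : 0 ≤ b) (A : Mat) (a : Vec) (x : ℝ) :
    nrm s (omseForm L s A a b x) ≤ b := by
  rw [nrm_eq, whiten_omseForm]
  exact norm_clipBall_le hb _

theorem Y_apply (A : Mat) (a : Vec) (x : ℝ) (i : Fin 2) :
    Y L A a x i = A i 0 * L x 0 + A i 1 * L x 1 - a i := by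
  simp only [Y, Pi.sub_apply, Matrix.mulVec, dotProduct, Fin.sum_univ_two]

theorem Regular.integrable_Y (h : Regular P L) (A : Mat) (a : Vec) :
    Integrable (fun x => Y L A a x) P := by
  have := h.finite
  refine Integrable.of_eval fun i => ?_
  simp_rw [Y_apply]
  exact (((h.integrable 0).const_mul _).add ((h.integrable 1).const_mul _)).sub
    (integrable_const _)

theorem Regular.integrable_whiten_Y (h : Regular P L) (s : ℝ) (A : Mat) (a : Vec) :
    Integrable (fun x => whiten s (Y L A a x)) P :=
  (LinearMap.toContinuousLinearMap (whiten s)).integrable_comp (h.integrable_Y A a)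

/-- The family `d_s⁻¹ Y`, linear in the multipliers. -/
def scoreFamily (L : ℝ → Vec) (s : ℝ) : Par →ₗ[ℝ] ℝ → EuclideanSpace ℝ (Fin 2) where
  toFun v x := whiten s (Y L (Matrix.of v.1) v.2 x)
  map_add' v w := by
    ext1 x
    rw [Pi.add_apply, ← map_add]
    congr 1
    ext i
    simp only [Y_apply, Matrix.of_apply, Pi.add_apply, Prod.fst_add, Prod.snd_add]
    ring
  map_smul' c v := by
    ext1 x
    rw [Pi.smul_apply, RingHom.id_apply, ← map_smul]
    congr 1
    ext i
    simp only [Y_apply, Matrix.of_apply, Pi.smul_apply, Prod.smul_fst, Prod.smul_snd, smul_eq_mul]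
    ring

/-- The functional `A ↦ tr (d_s⁻² A)`. -/
def traceFunctional (s : ℝ) : Par →ₗ[ℝ] ℝ where
  toFun v := v.1 0 0 + (s⁻¹) ^ 2 * v.1 1 1
  map_add' v w := by simp only [Prod.fst_add, Pi.add_apply]; ring
  map_smul' c v := by
    simp only [Prod.smul_fst, Pi.smul_apply, smul_eq_mul, RingHom.id_apply]; ring

theorem traceFunctional_ne_zero (s : ℝ) : traceFunctional s ≠ 0 := by
  intro h
  have := LinearMap.congr_fun h (fun i j => (1 : Mat) i j, 0)
  simp only [traceFunctional, LinearMap.coe_mk, AddHom.coe_mk, LinearMap.zero_apply,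
    Matrix.one_apply_eq] at this
  nlinarith [sq_nonneg s⁻¹]

theorem Regular.scoreFamily_ne_zero (h : Regular P L) (hs : s ≠ 0) (v : Par) (hv : v ≠ 0) :
    ∀ᵐ x ∂P, scoreFamily L s v x ≠ 0 := by
  have : Matrix.of v.1 ≠ 0 ∨ v.2 ≠ 0 := by
    by_contra! hcon
    exact hv (Prod.ext (Matrix.of.injective hcon.1) hcon.2)
  filter_upwards [h.nondeg (Matrix.of v.1) v.2 this] with x hx
  exact (map_ne_zero_iff _ (whiten_injective hs)).2 hx

theorem Regular.scoreFamily_injective (h : Regular P L) (hs : s ≠ 0) (v : Par)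
    (hv : scoreFamily L s v =ᵐ[P] 0) : v = 0 := by
  by_contra hne
  have : ∀ᵐ _ ∂P, False := by
    filter_upwards [hv, h.scoreFamily_ne_zero hs v hne] with x h1 h2
    exact h2 h1
  exact h.ne_zero (by simpa using this)

theorem integrable_mul_of_bound {f g : ℝ → ℝ} {C : ℝ} (hf : AEStronglyMeasurable f P)
    (hb : ∀ x, |f x| ≤ C) (hg : Integrable g P) : Integrable (fun x => f x * g x) P :=
  hg.bdd_mul (c := C) hf (ae_of_all _ hb)

/-- The side conditions of a bounded influence function in terms of the family `Y`. -/
theorem IsIF.integral_inner (h : Regular P L) (hs : 0 < s) {ψ : ℝ → Vec} (hψ : IsIF P L ψ)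
    {c : ℝ} (hc : ∀ x, nrm s (ψ x) ≤ c) (A : Mat) (a : Vec) :
    ∫ x, inner ℝ (whiten s (ψ x)) (whiten s (Y L A a x)) ∂P = ((dMat s)⁻¹ ^ 2 * A).trace := by
  have := h.finite
  have hb : ∀ i x, |ψ x i| ≤ max 1 s * c := fun i x =>
    (abs_apply_le hs (ψ x) i).trans (by gcongr; exact hc x)
  have hi : ∀ i j, Integrable (fun x => ψ x i * L x j) P := fun i j =>
    integrable_mul_of_bound (hψ.memLp i).1 (hb i) (h.integrable j)
  have hi0 : ∀ i, Integrable (fun x => ψ x i) P := fun i =>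
    (hψ.memLp i).integrable one_le_two
  have hrow : ∀ i, ∫ x, ψ x i * Y L A a x i ∂P = A i i := by
    intro i
    have : ∀ x, ψ x i * Y L A a x i
        = A i 0 * (ψ x i * L x 0) + A i 1 * (ψ x i * L x 1) - a i * ψ x i := by
      intro x; rw [Y_apply]; ring
    simp_rw [this]
    have h1 := ((hi i 0).const_mul (A i 0)).add ((hi i 1).const_mul (A i 1))
    rw [integral_sub (by exact h1) ((hi0 i).const_mul _),
      integral_add ((hi i 0).const_mul _) ((hi i 1).const_mul _), integral_const_mul,
      integral_const_mul, integral_const_mul, hψ.fisher, hψ.fisher, hψ.centered]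
    have hone : ∀ i, A i 0 * (1 : Mat) i 0 + A i 1 * (1 : Mat) i 1 - a i * 0 = A i i :=
      Fin.forall_fin_two.2 ⟨by simp, by simp⟩
    exact hone i
  have hiY : ∀ i, Integrable (fun x => ψ x i * Y L A a x i) P := fun i =>
    integrable_mul_of_bound (hψ.memLp i).1 (hb i) ((h.integrable_Y A a).eval i)
  simp_rw [inner_whiten hs.ne']
  rw [integral_add (hiY 0) ((hiY 1).const_mul _), integral_const_mul, hrow, hrow,
    trace_dMat_mul hs.ne']

/-- Testing with `(0, eᵢ)` gives centering, testing with `(Eᵢⱼ, 0)` gives `E ψᵢ Λⱼ`; boundedness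
gives square integrability. -/
theorem isIF_of_integral_inner (h : Regular P L) (hs : 0 < s) {ψ : ℝ → Vec}
    (hψ : AEStronglyMeasurable ψ P) {c : ℝ} (hc : ∀ x, nrm s (ψ x) ≤ c)
    (hi : ∀ v, ∫ x, inner ℝ (whiten s (ψ x)) (scoreFamily L s v x) ∂P = traceFunctional s v) :
    IsIF P L ψ := by
  have := h.finite
  have hb : ∀ i x, |ψ x i| ≤ max 1 s * c := fun i x =>
    (abs_apply_le hs (ψ x) i).trans (by gcongr; exact hc x)
  have hm : ∀ i, AEStronglyMeasurable (fun x => ψ x i) P := fun i =>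
    (continuous_apply i).comp_aestronglyMeasurable hψ
  have hs' : (s⁻¹) ^ 2 ≠ 0 := by positivity
  refine ⟨fun i => MemLp.of_bound (hm i) _ (ae_of_all _ (hb i)), fun i => ?_, fun i j => ?_⟩
  · have := hi (0, Pi.single i 1)
    simp only [scoreFamily, LinearMap.coe_mk, AddHom.coe_mk, inner_whiten hs.ne', Y_apply,
      Matrix.of_apply, traceFunctional] at this
    fin_cases i
    · simpa [integral_neg] using this
    · simpa [integral_neg, integral_const_mul, hs', hs.ne'] using this
  · have := hi (fun k l => Matrix.single i j (1 : ℝ) k l, 0)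
    simp only [scoreFamily, LinearMap.coe_mk, AddHom.coe_mk, inner_whiten hs.ne', Y_apply,
      Matrix.of_apply, traceFunctional] at this
    fin_cases i <;> fin_cases j <;>
      simpa [integral_const_mul, hs', hs.ne', Matrix.single_apply] using this

theorem GES_le {ψ : ℝ → Vec} {c : ℝ} (h : ∀ x, nrm s (ψ x) ≤ c) :
    GES s ψ ≤ ENNReal.ofReal c :=
  iSup_le fun x => ENNReal.ofReal_le_ofReal (h x)

theorem nrm_le_of_GES_le {ψ : ℝ → Vec} {c : ℝ} (hc : 0 ≤ c) (h : GES s ψ ≤ ENNReal.ofReal c)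
    (x : ℝ) : nrm s (ψ x) ≤ c :=
  (ENNReal.ofReal_le_ofReal_iff hc).1 ((le_iSup (fun x => ENNReal.ofReal (nrm s (ψ x))) x).trans h)

theorem nrm_le_toReal_GES {ψ : ℝ → Vec} (h : GES s ψ ≠ ⊤) (x : ℝ) :
    nrm s (ψ x) ≤ (GES s ψ).toReal :=
  nrm_le_of_GES_le ENNReal.toReal_nonneg (ENNReal.ofReal_toReal h).ge x

theorem IsIF.aestronglyMeasurable_whiten {ψ : ℝ → Vec} (hψ : IsIF P L ψ) (s : ℝ) :
    AEStronglyMeasurable (fun x => whiten s (ψ x)) P :=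
  (continuous_whiten s).comp_aestronglyMeasurable
    (aemeasurable_pi_iff.2 fun i => (hψ.memLp i).1.aemeasurable).aestronglyMeasurable

theorem IsIF.integrable_inner (h : Regular P L) {ψ : ℝ → Vec} (hψ : IsIF P L ψ)
    {c : ℝ} (hc : ∀ x, nrm s (ψ x) ≤ c) (A : Mat) (a : Vec) :
    Integrable (fun x => inner ℝ (whiten s (ψ x)) (whiten s (Y L A a x))) P :=
  integrable_inner_of_bound (hψ.aestronglyMeasurable_whiten s) (ae_of_all _ hc)
    (h.integrable_whiten_Y s A a)

/-! ### Minimal bias -/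

section MBRE

theorem IsMBREMult.integral_pos {A : Mat} {a : Vec} {b : ℝ} (hm : IsMBREMult P L s A a b) :
    0 < ∫ x, nrm s (Y L A a x) ∂P := by
  refine (integral_nonneg fun x => norm_nonneg _).lt_of_ne' fun h0 => hm.pos.ne' ?_
  -- Division by zero yields `0`, so a vanishing denominator would contradict `b > 0`.
  rw [hm.attained, biasRatio, h0, div_zero]

theorem IsMBREMult.eq_bound {A A' : Mat} {a a' : Vec} {b b' : ℝ} (hm : IsMBREMult P L s A a b)
    (hm' : IsMBREMult P L s A' a' b') : b = b' :=
  le_antisymm (hm.attained.trans_le (hm'.max A a hm.integral_pos))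
    (hm'.attained.trans_le (hm.max A' a' hm'.integral_pos))

/-- Weak duality: the constraints turn the trace into `E⟨d_s⁻¹φ, d_s⁻¹Y⟩`, to which Cauchy-Schwarz
applies pointwise. -/
theorem IsIF.trace_le (h : Regular P L) (hs : 0 < s) {φ : ℝ → Vec} (hφ : IsIF P L φ) {c : ℝ}
    (hc : ∀ x, nrm s (φ x) ≤ c) (A : Mat) (a : Vec) :
    ((dMat s)⁻¹ ^ 2 * A).trace ≤ c * ∫ x, nrm s (Y L A a x) ∂P := by
  rw [← hφ.integral_inner h hs hc A a, ← integral_const_mul]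
  refine integral_mono (hφ.integrable_inner h hc A a)
    ((h.integrable_whiten_Y s A a).norm.const_mul c) fun x => (real_inner_le_norm _ _).trans ?_
  have := hc x
  rw [nrm_eq] at this ⊢
  gcongr

theorem IsMBREMult.trace_eq {A : Mat} {a : Vec} {b : ℝ} (hm : IsMBREMult P L s A a b) :
    ((dMat s)⁻¹ ^ 2 * A).trace = b * ∫ x, nrm s (Y L A a x) ∂P := by
  nth_rw 1 [hm.attained]
  rw [biasRatio, div_mul_cancel₀ _ hm.integral_pos.ne']

theorem IsMBREMult.le_of_isIF (h : Regular P L) (hs : 0 < s) {A : Mat} {a : Vec} {b c : ℝ}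
    (hm : IsMBREMult P L s A a b) {φ : ℝ → Vec} (hφ : IsIF P L φ) (hc : ∀ x, nrm s (φ x) ≤ c) :
    b ≤ c := by
  have := hφ.trace_le h hs hc A a
  rw [hm.trace_eq] at this
  exact le_of_mul_le_mul_right this hm.integral_pos

/-- Equality in Cauchy-Schwarz: expanding `‖φ - toSphere b y‖²` gives at most `b² - 2b² + b² = 0`.
-/
theorem eq_toSphere_of_inner_eq {H : Type*} [NormedAddCommGroup H] [InnerProductSpace ℝ H] {b : ℝ}
    {φ y : H} (hy : y ≠ 0) (hφ : ‖φ‖ ≤ b) (h : inner ℝ φ y = b * ‖y‖) : φ = toSphere b y := by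
  have hy' : 0 < ‖y‖ := norm_pos_iff.2 hy
  have hb : 0 ≤ b := (norm_nonneg _).trans hφ
  rw [← sub_eq_zero, ← norm_eq_zero, ← sq_eq_zero_iff]
  refine le_antisymm ?_ (sq_nonneg _)
  have h1 := norm_toSphere_le hb y
  have h2 : inner ℝ φ (toSphere b y) = b ^ 2 := by
    rw [toSphere, inner_smul_right, h]
    field_simp
  rw [norm_sub_sq_real, h2]
  nlinarith [norm_nonneg φ, norm_nonneg (toSphere b y)]

/-- Weak duality is an equality at the multipliers, so the nonnegative function `b n(Y) - ⟨d_s⁻¹φ,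
d_s⁻¹Y⟩` has integral zero. -/
theorem IsMBREMult.ae_eq (h : Regular P L) (hs : 0 < s) {A : Mat} {a : Vec} {b : ℝ}
    (hm : IsMBREMult P L s A a b) {φ : ℝ → Vec} (hφ : IsIF P L φ) (hc : ∀ x, nrm s (φ x) ≤ b) :
    φ =ᵐ[P] mbreForm L s A a b := by
  have hne : A ≠ 0 ∨ a ≠ 0 := by
    by_contra! hcon
    have := hm.integral_pos
    simp [nrm_eq, Y, hcon.1, hcon.2] at this
  have hin := hφ.integrable_inner h hc A a
  have hn := (h.integrable_whiten_Y s A a).norm.const_mul b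
  have hle : ∀ x, 0 ≤ b * ‖whiten s (Y L A a x)‖
      - inner ℝ (whiten s (φ x)) (whiten s (Y L A a x)) := by
    intro x
    rw [sub_nonneg]
    refine (real_inner_le_norm _ _).trans ?_
    have := hc x
    rw [nrm_eq] at this
    gcongr
  have hzero : ∫ x, (b * ‖whiten s (Y L A a x)‖
      - inner ℝ (whiten s (φ x)) (whiten s (Y L A a x))) ∂P = 0 := by
    rw [integral_sub hn hin, hφ.integral_inner h hs hc A a, hm.trace_eq, integral_const_mul]
    exact sub_self _
  rw [integral_eq_zero_iff_of_nonneg hle (hn.sub hin)] at hzero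
  filter_upwards [hzero, h.nondeg A a hne] with x hx hYx
  refine whiten_injective hs.ne' ?_
  rw [whiten_mbreForm]
  refine eq_toSphere_of_inner_eq ((map_ne_zero_iff _ (whiten_injective hs.ne')).2 hYx) (hc x) ?_
  simp only [Pi.zero_apply] at hx
  linarith

theorem exists_isMBREMult (h : Regular P L) (hs : 0 < s) :
    ∃ A a b, IsMBREMult P L s A a b := by
  obtain ⟨v, hv0, hv⟩ := exists_toSphere_multiplier (scoreFamily L s)
    (fun v => h.integrable_whiten_Y s _ _) (h.scoreFamily_injective hs.ne')
    (h.scoreFamily_ne_zero hs.ne') (traceFunctional s) (traceFunctional_ne_zero s)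
  set b := ∫ x, ‖scoreFamily L s v x‖ ∂P with hb
  have hIF : IsIF P L (mbreForm L s (Matrix.of v.1) v.2 b) := by
    refine isIF_of_integral_inner h hs ?_ (nrm_mbreForm_le hv0.le _ _) fun z => ?_
    · have hY := h.integrable_whiten_Y s (Matrix.of v.1) v.2
      exact ((aemeasurable_const.div hY.1.norm.aemeasurable).aestronglyMeasurable).smul
        (h.integrable_Y _ _).1
    · rw [← hv z]
      simp_rw [whiten_mbreForm]
      rfl
  have htr := hIF.integral_inner h hs (nrm_mbreForm_le hv0.le _ _) (Matrix.of v.1) v.2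
  simp_rw [whiten_mbreForm, inner_toSphere_self] at htr
  rw [integral_const_mul] at htr
  refine ⟨Matrix.of v.1, v.2, b, hv0, ?_, fun A' a' hpos => ?_, hIF⟩
  · rw [biasRatio, ← htr, eq_div_iff]
    · rfl
    · exact hv0.ne'
  -- Maximality is weak duality for the influence function just constructed.
  · rw [biasRatio, div_le_iff₀ hpos]
    exact hIF.trace_le h hs (nrm_mbreForm_le hv0.le _ _) A' a'

theorem ofReal_le_GES {φ : ℝ → Vec} {b : ℝ} (h : ∀ c, (∀ x, nrm s (φ x) ≤ c) → b ≤ c) :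
    ENNReal.ofReal b ≤ GES s φ := by
  rcases eq_or_ne (GES s φ) ⊤ with htop | htop
  · simp [htop]
  · rw [← ENNReal.ofReal_toReal htop]
    exact ENNReal.ofReal_le_ofReal (h _ (nrm_le_toReal_GES htop))

theorem IsMBREMult.isMBRE (h : Regular P L) (hs : 0 < s) {A : Mat} {a : Vec} {b : ℝ}
    (hm : IsMBREMult P L s A a b) (r : ℝ) : IsMBRE P L s r (mbreForm L s A a b) :=
  ⟨hm.isIF, fun _ hφ => mul_le_mul_right ((GES_le (nrm_mbreForm_le hm.pos.le A a)).trans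
    (ofReal_le_GES fun _ hc => hm.le_of_isIF h hs hφ hc)) _⟩

theorem IsMBREMult.ae_eq_of_isMBRE (h : Regular P L) (hs : 0 < s) {A : Mat} {a : Vec} {b : ℝ}
    (hm : IsMBREMult P L s A a b) (hr : 0 < r) {ψ : ℝ → Vec} (hψ : IsMBRE P L s r ψ) :
    ψ =ᵐ[P] mbreForm L s A a b := by
  refine hm.ae_eq h hs hψ.1 (nrm_le_of_GES_le hm.pos.le ?_)
  have := hψ.2 _ hm.isIF
  rw [asBias, asBias, ENNReal.mul_le_mul_iff_right (by simpa using hr) ENNReal.ofReal_ne_top] at this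
  exact this.trans (GES_le (nrm_mbreForm_le hm.pos.le A a))

theorem uniqueOfForm_isMBRE (h : Regular P L) (hs : 0 < s) (hr : 0 < r) :
    UniqueOfForm P (IsMBRE P L s r) (IsMBREMult P L s) (mbreForm L s) := by
  obtain ⟨A, a, b, hm⟩ := exists_isMBREMult h hs
  exact ⟨⟨_, hm.isMBRE h hs r⟩,
    fun ψ φ hψ hφ => (hm.ae_eq_of_isMBRE h hs hr hψ).trans (hm.ae_eq_of_isMBRE h hs hr hφ).symm,
    fun ψ hψ => ⟨A, a, b, hm, hm.ae_eq_of_isMBRE h hs hr hψ⟩,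
    fun A a b hm => hm.isMBRE h hs r⟩

end MBRE

/-! ### Minimal mean squared error -/

section OMSE

theorem IsIF.integrable_nrm_sq (hs : s ≠ 0) {ψ : ℝ → Vec} (hψ : IsIF P L ψ) :
    Integrable (fun x => nrm s (ψ x) ^ 2) P := by
  simp_rw [nrm_sq hs]
  exact (hψ.memLp 0).integrable_sq.add ((hψ.memLp 1).integrable_sq.const_mul _)

theorem IsIF.trace_asVar (hs : s ≠ 0) {ψ : ℝ → Vec} (hψ : IsIF P L ψ) :
    ((dMat s)⁻¹ ^ 2 * asVar P ψ).trace = ∫ x, nrm s (ψ x) ^ 2 ∂P := by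
  simp_rw [trace_dMat_mul hs, nrm_sq hs, asVar, Matrix.of_apply, ← sq]
  rw [integral_add (hψ.memLp 0).integrable_sq ((hψ.memLp 1).integrable_sq.const_mul _),
    integral_const_mul]

theorem IsIF.asMSE_eq (hs : s ≠ 0) {ψ : ℝ → Vec} (hψ : IsIF P L ψ) (h : GES s ψ ≠ ⊤) :
    asMSE P s r ψ
      = ENNReal.ofReal (r ^ 2 * (GES s ψ).toReal ^ 2 + ∫ x, nrm s (ψ x) ^ 2 ∂P) := by
  rw [asMSE, hψ.trace_asVar hs, ENNReal.ofReal_add (by positivity)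
    (integral_nonneg fun x => by positivity), ENNReal.ofReal_mul (by positivity),
    ENNReal.ofReal_pow ENNReal.toReal_nonneg, ENNReal.ofReal_toReal h]

theorem IsIF.asMSE_le (hs : s ≠ 0) {ψ : ℝ → Vec} (hψ : IsIF P L ψ) {c : ℝ} (hc0 : 0 ≤ c)
    (hc : ∀ x, nrm s (ψ x) ≤ c) :
    asMSE P s r ψ ≤ ENNReal.ofReal (r ^ 2 * c ^ 2 + ∫ x, nrm s (ψ x) ^ 2 ∂P) := by
  have hle := GES_le hc
  have hne : GES s ψ ≠ ⊤ := ne_top_of_le_ne_top ENNReal.ofReal_ne_top hle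
  rw [hψ.asMSE_eq hs hne]
  have : (GES s ψ).toReal ≤ c := ENNReal.toReal_le_of_le_ofReal hc0 hle
  gcongr

theorem asMSE_eq_top (hr : 0 < r) {ψ : ℝ → Vec} (h : GES s ψ = ⊤) : asMSE P s r ψ = ⊤ := by
  have : ENNReal.ofReal (r ^ 2) ≠ 0 := by
    simpa using hr.ne'
  rw [asMSE, h, ENNReal.top_pow two_ne_zero, ENNReal.mul_top this, top_add]

/-- The clipped form is optimal among bounded influence functions, with a quadratic gap. -/
theorem IsOMSEMult.risk_add_le (h : Regular P L) (hs : 0 < s) {A : Mat} {a : Vec} {b c : ℝ}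
    (hm : IsOMSEMult P L s r A a b) {φ : ℝ → Vec} (hφ : IsIF P L φ) (hc : ∀ x, nrm s (φ x) ≤ c) :
    r ^ 2 * b ^ 2 + ∫ x, nrm s (omseForm L s A a b x) ^ 2 ∂P
      + (∫ x, nrm s (φ x - omseForm L s A a b x) ^ 2 ∂P + r ^ 2 * (c - b) ^ 2)
      ≤ r ^ 2 * c ^ 2 + ∫ x, nrm s (φ x) ^ 2 ∂P := by
  have := h.finite
  have hm' := hm.isIF
  have hψ : ∀ x, nrm s (omseForm L s A a b x) ≤ b := nrm_omseForm_le hm.pos.le A a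
  set ψ := omseForm L s A a b with hψdef
  have hdiff : Integrable (fun x => nrm s (φ x - ψ x) ^ 2) P := by
    simp_rw [nrm_sq hs.ne', Pi.sub_apply]
    exact ((hφ.memLp 0).sub (hm'.memLp 0)).integrable_sq.add
      (((hφ.memLp 1).sub (hm'.memLp 1)).integrable_sq.const_mul _)
  have hsq1 := hφ.integrable_nrm_sq hs.ne'
  have hsq2 := hm'.integrable_nrm_sq hs.ne'
  have hin1 := hφ.integrable_inner h hc A a
  have hin2 := hm'.integrable_inner h hψ A a
  have hcl : Integrable (fun x => max (nrm s (Y L A a x) - b) 0) P :=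
    integrable_clip (h.integrable_whiten_Y s A a).norm b
  have key : ∀ x, nrm s (ψ x) ^ 2 + nrm s (φ x - ψ x) ^ 2
      ≤ nrm s (φ x) ^ 2 + 2 * (c - b) * max (nrm s (Y L A a x) - b) 0
        - 2 * inner ℝ (whiten s (φ x)) (whiten s (Y L A a x))
        + 2 * inner ℝ (whiten s (ψ x)) (whiten s (Y L A a x)) := by
    intro x
    have h1 := inner_sub_clipBall_le (φ := whiten s (φ x)) hm.pos.le (hc x) (whiten s (Y L A a x))
    rw [← whiten_omseForm, ← hψdef, ← nrm_eq] at h1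
    simp only [nrm_eq, map_sub, norm_sub_sq_real]
    rw [inner_sub_left, inner_sub_right, inner_sub_right, real_inner_self_eq_norm_sq] at h1
    rw [nrm_eq] at h1
    linarith
  have hcl' := hcl.const_mul (2 * (c - b))
  have e1 := hsq1.add hcl'
  have e2 := e1.sub (hin1.const_mul 2)
  -- Both inner products integrate to the same trace and cancel. The clipping equation leaves `2 (c
  -- - b) r² b = r² (c² - b² - (c - b)²)`.
  have hint := integral_mono (hsq2.add hdiff) (e2.add (hin2.const_mul 2)) key
  rw [integral_add' hsq2 hdiff, integral_add' e2 (hin2.const_mul 2),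
    integral_sub' e1 (hin1.const_mul 2), integral_add' hsq1 hcl', integral_const_mul,
    integral_const_mul, integral_const_mul, hφ.integral_inner h hs hc, hm'.integral_inner h hs hψ,
    ← hm.clip] at hint
  nlinarith

/-- The gap inequality, used in both directions and added up, leaves `2 r² (b' - b)² ≤ 0`. -/
theorem IsOMSEMult.eq_bound (h : Regular P L) (hs : 0 < s) (hr : 0 < r) {A A' : Mat} {a a' : Vec}
    {b b' : ℝ} (hm : IsOMSEMult P L s r A a b) (hm' : IsOMSEMult P L s r A' a' b') : b = b' := by
  have h1 := hm.risk_add_le h hs hm'.isIF (nrm_omseForm_le hm'.pos.le A' a')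
  have h2 := hm'.risk_add_le h hs hm.isIF (nrm_omseForm_le hm.pos.le A a)
  have h3 : 0 ≤ ∫ x, nrm s (omseForm L s A' a' b' x - omseForm L s A a b x) ^ 2 ∂P :=
    integral_nonneg fun x => by positivity
  have h4 : 0 ≤ ∫ x, nrm s (omseForm L s A a b x - omseForm L s A' a' b' x) ^ 2 ∂P :=
    integral_nonneg fun x => by positivity
  have h5 : (r * (b' - b)) ^ 2 ≤ 0 := by nlinarith
  have h6 := pow_eq_zero_iff two_ne_zero |>.1 (le_antisymm h5 (sq_nonneg _))
  rcases mul_eq_zero.1 h6 with h7 | h7 <;> linarith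

theorem exists_isOMSEMult (h : Regular P L) (hs : 0 < s) (hr : 0 < r) :
    ∃ A a b, IsOMSEMult P L s r A a b := by
  have := h.finite
  obtain ⟨v, b, hb, hclip, hv⟩ := exists_clipBall_multiplier (scoreFamily L s)
    (fun v => h.integrable_whiten_Y s _ _) (h.scoreFamily_injective hs.ne')
    (traceFunctional s) (traceFunctional_ne_zero s) hr
  refine ⟨Matrix.of v.1, v.2, b, hb, hclip, ?_⟩
  refine isIF_of_integral_inner h hs ?_ (nrm_omseForm_le hb.le _ _) fun z => ?_
  · have hY := h.integrable_whiten_Y s (Matrix.of v.1) v.2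
    exact ((aemeasurable_const.min
      (aemeasurable_const.div hY.1.norm.aemeasurable)).aestronglyMeasurable).smul
      (h.integrable_Y _ _).1
  · rw [← hv z]
    simp_rw [whiten_omseForm]
    rfl

theorem IsOMSEMult.isOMSE (h : Regular P L) (hs : 0 < s) (hr : 0 < r) {A : Mat} {a : Vec} {b : ℝ}
    (hm : IsOMSEMult P L s r A a b) : IsOMSE P L s r (omseForm L s A a b) := by
  refine ⟨hm.isIF, fun φ hφ => ?_⟩
  rcases eq_or_ne (GES s φ) ⊤ with htop | htop
  · rw [asMSE_eq_top hr htop]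
    exact le_top
  · rw [hφ.asMSE_eq hs.ne' htop]
    refine (hm.isIF.asMSE_le hs.ne' hm.pos.le (nrm_omseForm_le hm.pos.le A a)).trans
      (ENNReal.ofReal_le_ofReal ?_)
    have h1 := hm.risk_add_le h hs hφ (nrm_le_toReal_GES htop)
    have h2 : 0 ≤ ∫ x, nrm s (φ x - omseForm L s A a b x) ^ 2 ∂P :=
      integral_nonneg fun x => by positivity
    have h3 : 0 ≤ r ^ 2 * ((GES s φ).toReal - b) ^ 2 := by positivity
    linarith

theorem IsOMSEMult.ae_eq_of_isOMSE (h : Regular P L) (hs : 0 < s) (hr : 0 < r) {A : Mat} {a : Vec}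
    {b : ℝ} (hm : IsOMSEMult P L s r A a b) {ψ : ℝ → Vec} (hψ : IsOMSE P L s r ψ) :
    ψ =ᵐ[P] omseForm L s A a b := by
  have hle := (hψ.2 _ hm.isIF).trans
    (hm.isIF.asMSE_le hs.ne' hm.pos.le (nrm_omseForm_le hm.pos.le A a))
  have htop : GES s ψ ≠ ⊤ := fun htop => by
    rw [asMSE_eq_top hr htop, top_le_iff] at hle
    exact ENNReal.ofReal_ne_top hle
  have hpos : 0 ≤ ∫ x, nrm s (omseForm L s A a b x) ^ 2 ∂P :=
    integral_nonneg fun x => by positivity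
  rw [hψ.1.asMSE_eq hs.ne' htop, ENNReal.ofReal_le_ofReal_iff (by positivity)] at hle
  have h1 := hm.risk_add_le h hs hψ.1 (nrm_le_toReal_GES htop)
  have h2 : 0 ≤ ∫ x, nrm s (ψ x - omseForm L s A a b x) ^ 2 ∂P :=
    integral_nonneg fun x => by positivity
  have h3 : 0 ≤ r ^ 2 * ((GES s ψ).toReal - b) ^ 2 := by positivity
  have h4 : ∫ x, nrm s (ψ x - omseForm L s A a b x) ^ 2 ∂P = 0 := by linarith
  have hint : Integrable (fun x => nrm s (ψ x - omseForm L s A a b x) ^ 2) P := by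
    simp_rw [nrm_sq hs.ne', Pi.sub_apply]
    exact ((hψ.1.memLp 0).sub (hm.isIF.memLp 0)).integrable_sq.add
      (((hψ.1.memLp 1).sub (hm.isIF.memLp 1)).integrable_sq.const_mul _)
  rw [integral_eq_zero_iff_of_nonneg (fun x => by positivity) hint] at h4
  filter_upwards [h4] with x hx
  refine whiten_injective hs.ne' (sub_eq_zero.1 ?_)
  rw [← map_sub, ← norm_eq_zero, ← nrm_eq]
  simpa using hx

theorem uniqueOfForm_isOMSE (h : Regular P L) (hs : 0 < s) (hr : 0 < r) :
    UniqueOfForm P (IsOMSE P L s r) (IsOMSEMult P L s r) (omseForm L s) := by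
  obtain ⟨A, a, b, hm⟩ := exists_isOMSEMult h hs hr
  exact ⟨⟨_, hm.isOMSE h hs hr⟩,
    fun ψ φ hψ hφ => (hm.ae_eq_of_isOMSE h hs hr hψ).trans (hm.ae_eq_of_isOMSE h hs hr hφ).symm,
    fun ψ hψ => ⟨A, a, b, hm, hm.ae_eq_of_isOMSE h hs hr hψ⟩,
    fun A a b hm => hm.isOMSE h hs hr⟩

end OMSE

end GPD

end

/-! ### Equivariance under changes of observation and parameter scale -/

noncomputable section

namespace GPD

theorem dMat_mulVec_apply (δ : ℝ) (v : Vec) (i : Fin 2) : (dMat δ *ᵥ v) i = ![1, δ] i * v i := by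
  rw [dMat, Matrix.mulVec_diagonal]

theorem dMat_one : dMat 1 = 1 := by
  rw [dMat, ← Matrix.diagonal_one]
  congr 1
  ext i
  fin_cases i <;> rfl

theorem dMat_mul_dMat (δ ε : ℝ) : dMat δ * dMat ε = dMat (δ * ε) := by
  rw [dMat, dMat, dMat, Matrix.diagonal_mul_diagonal]
  congr 1
  ext i
  fin_cases i <;> simp

theorem dMat_inv_eq {δ : ℝ} (hδ : δ ≠ 0) : (dMat δ)⁻¹ = dMat δ⁻¹ := dMat_inv hδ

theorem dMat_mulVec_injective {δ : ℝ} (hδ : δ ≠ 0) : Function.Injective (dMat δ).mulVec := by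
  intro v w h
  have := congr_arg (dMat δ⁻¹).mulVec h
  rwa [Matrix.mulVec_mulVec, Matrix.mulVec_mulVec, dMat_mul_dMat, inv_mul_cancel₀ hδ, dMat_one,
    Matrix.one_mulVec, Matrix.one_mulVec] at this

theorem whiten_dMat_mulVec {s δ : ℝ} (hs : s ≠ 0) (hδ : δ ≠ 0) (v : Vec) :
    whiten (s * δ) (dMat δ *ᵥ v) = whiten s v := by
  ext i
  rw [whiten_apply (mul_ne_zero hs hδ), whiten_apply hs, dMat_mulVec_apply]
  fin_cases i
  · simp
  · simp [field]

theorem nrm_dMat_mulVec {s δ : ℝ} (hs : s ≠ 0) (hδ : δ ≠ 0) (v : Vec) :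
    nrm (s * δ) (dMat δ *ᵥ v) = nrm s v := by
  rw [nrm_eq, nrm_eq, whiten_dMat_mulVec hs hδ]

theorem dMat_mul_mul_apply (δ : ℝ) (A : Mat) (i j : Fin 2) :
    (dMat δ * A * dMat δ) i j = ![1, δ] i * A i j * ![1, δ] j := by
  rw [dMat, Matrix.mul_diagonal, Matrix.diagonal_mul]

theorem dMat_conj_inv {δ : ℝ} (hδ : δ ≠ 0) (A : Mat) :
    dMat δ * (dMat δ⁻¹ * A * dMat δ⁻¹) * dMat δ = A := by
  ext i j
  rw [dMat_mul_mul_apply, dMat_mul_mul_apply]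
  fin_cases i <;> fin_cases j <;> simp [field]

theorem dMat_mulVec_inv {δ : ℝ} (hδ : δ ≠ 0) (a : Vec) : dMat δ *ᵥ (dMat δ⁻¹ *ᵥ a) = a := by
  rw [Matrix.mulVec_mulVec, dMat_mul_dMat, mul_inv_cancel₀ hδ, dMat_one, Matrix.one_mulVec]

/-- A model arises from another one by an invertible change of the observations and a rescaling
of the second parameter, under which the scores transform by `d_δ⁻¹`. -/
structure Transfer (e : ℝ ≃ᵐ ℝ) (δ : ℝ) (P P' : Measure ℝ) (L L' : ℝ → Vec) : Prop where
  pos : 0 < δ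
  map_eq : P' = P.map e
  score : ∀ᵐ x ∂P, L' (e x) = dMat δ⁻¹ *ᵥ L x

/-- The transformation of influence functions that belongs to `Transfer`. -/
def push (e : ℝ ≃ᵐ ℝ) (δ : ℝ) (ψ : ℝ → Vec) (x : ℝ) : Vec := dMat δ *ᵥ ψ (e.symm x)

theorem push_apply (e : ℝ ≃ᵐ ℝ) (δ : ℝ) (ψ : ℝ → Vec) (x : ℝ) :
    push e δ ψ (e x) = dMat δ *ᵥ ψ x := by
  rw [push, e.symm_apply_apply]

theorem push_symm (e : ℝ ≃ᵐ ℝ) {δ : ℝ} (hδ : δ ≠ 0) (ψ : ℝ → Vec) :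
    push e δ (push e.symm δ⁻¹ ψ) = ψ := by
  ext1 x
  simp only [push, MeasurableEquiv.symm_symm, MeasurableEquiv.apply_symm_apply,
    dMat_mulVec_inv hδ]

theorem IsIF.congr {P : Measure ℝ} {L ψ φ : ℝ → Vec} (h : IsIF P L ψ) (hψ : ψ =ᵐ[P] φ) :
    IsIF P L φ := by
  refine ⟨fun i => (memLp_congr_ae ?_).1 (h.memLp i), fun i => ?_, fun i j => ?_⟩
  · filter_upwards [hψ] with x hx
    rw [hx]
  · rw [← h.centered i]
    refine integral_congr_ae ?_
    filter_upwards [hψ] with x hx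
    rw [hx]
  · rw [← h.fisher i j]
    refine integral_congr_ae ?_
    filter_upwards [hψ] with x hx
    rw [hx]

namespace Transfer

variable {e : ℝ ≃ᵐ ℝ} {δ s r : ℝ} {P P' : Measure ℝ} {L L' : ℝ → Vec}

theorem ae_iff (h : Transfer e δ P P' L L') {p : ℝ → Prop} :
    (∀ᵐ x ∂P', p x) ↔ ∀ᵐ x ∂P, p (e x) := by
  rw [h.map_eq, e.measurableEmbedding.ae_map_iff]

theorem integral_eq (h : Transfer e δ P P' L L') (f : ℝ → ℝ) :
    ∫ x, f x ∂P' = ∫ x, f (e x) ∂P := by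
  rw [h.map_eq, integral_map_equiv]

theorem symm (h : Transfer e δ P P' L L') : Transfer e.symm δ⁻¹ P' P L' L := by
  refine ⟨inv_pos.2 h.pos, by rw [h.map_eq, MeasurableEquiv.map_symm_map], ?_⟩
  rw [h.ae_iff]
  filter_upwards [h.score] with x hx
  rw [e.symm_apply_apply, hx, inv_inv, dMat_mulVec_inv h.pos.ne']

theorem trans {e' : ℝ ≃ᵐ ℝ} {δ' : ℝ} {P'' : Measure ℝ} {L'' : ℝ → Vec}
    (h : Transfer e δ P P' L L') (h' : Transfer e' δ' P' P'' L' L'') :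
    Transfer (e.trans e') (δ * δ') P P'' L L'' := by
  refine ⟨mul_pos h.pos h'.pos, ?_, ?_⟩
  · rw [h'.map_eq, h.map_eq, Measure.map_map e'.measurable e.measurable]
    rfl
  · filter_upwards [h.score, h.ae_iff.1 h'.score] with x hx hx'
    rw [MeasurableEquiv.trans_apply, hx', hx, Matrix.mulVec_mulVec, dMat_mul_dMat, _root_.mul_inv_rev]

/-- The right factor `d_δ` of the conjugated matrix cancels the `d_δ⁻¹` of the scores. -/
theorem Y_eq (h : Transfer e δ P P' L L') (A : Mat) (a : Vec) :
    ∀ᵐ x ∂P, Y L' (dMat δ * A * dMat δ) (dMat δ *ᵥ a) (e x) = dMat δ *ᵥ Y L A a x := by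
  filter_upwards [h.score] with x hx
  rw [Y, Y, hx, Matrix.mulVec_sub, Matrix.mulVec_mulVec, Matrix.mul_assoc, dMat_mul_dMat,
    mul_inv_cancel₀ h.pos.ne', dMat_one, Matrix.mul_one, ← Matrix.mulVec_mulVec]

theorem regular (h : Transfer e δ P P' L L') (hR : Regular P L) : Regular P' L' := by
  have := hR.finite
  have hδ := h.pos.ne'
  refine ⟨?_, ?_, fun i => ?_, fun A a hA => ?_⟩
  · rw [h.map_eq]
    infer_instance
  · rw [h.map_eq, Ne, Measure.map_eq_zero_iff e.measurable.aemeasurable]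
    exact hR.ne_zero
  · rw [h.map_eq, integrable_map_equiv]
    refine ((hR.integrable i).const_mul (![1, δ⁻¹] i)).congr ?_
    filter_upwards [h.score] with x hx
    simp only [Function.comp_apply, hx, dMat_mulVec_apply]
  · rw [h.ae_iff]
    have hne : dMat δ⁻¹ * A * dMat δ⁻¹ ≠ 0 ∨ dMat δ⁻¹ *ᵥ a ≠ 0 := by
      refine hA.imp (fun hA h0 => hA ?_) fun ha h0 => ha ?_
      · rw [← dMat_conj_inv hδ A, h0]; simp
      · rw [← dMat_mulVec_inv hδ a, h0]; simp
    have := h.Y_eq (dMat δ⁻¹ * A * dMat δ⁻¹) (dMat δ⁻¹ *ᵥ a)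
    rw [dMat_conj_inv hδ, dMat_mulVec_inv hδ] at this
    filter_upwards [this, hR.nondeg _ _ hne] with x hx hx'
    rw [hx]
    intro h0
    exact hx' (dMat_mulVec_injective hδ (h0.trans (Matrix.mulVec_zero _).symm))

theorem isIF (h : Transfer e δ P P' L L') {ψ : ℝ → Vec} (hψ : IsIF P L ψ) :
    IsIF P' L' (push e δ ψ) := by
  have hδ := h.pos.ne'
  refine ⟨fun i => ?_, fun i => ?_, fun i j => ?_⟩
  · rw [h.map_eq, e.measurableEmbedding.memLp_map_measure_iff]
    refine ((hψ.memLp i).const_mul (![1, δ] i)).ae_eq (ae_of_all _ fun x => ?_)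
    simp only [Function.comp_apply, push_apply, dMat_mulVec_apply]
  · rw [h.integral_eq]
    simp_rw [push_apply, dMat_mulVec_apply]
    rw [integral_const_mul, hψ.centered, mul_zero]
  · rw [h.integral_eq]
    have : (fun x => push e δ ψ (e x) i * L' (e x) j)
        =ᵐ[P] fun x => ![1, δ] i * ![1, δ⁻¹] j * (ψ x i * L x j) := by
      filter_upwards [h.score] with x hx
      rw [push_apply, hx, dMat_mulVec_apply, dMat_mulVec_apply]
      ring
    rw [integral_congr_ae this, integral_const_mul, hψ.fisher]
    fin_cases i <;> fin_cases j <;> simp [hδ]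

/-- The supremum runs over all points, null sets included, so the bijectivity of `e` on all of `ℝ`
is essential. -/
theorem GES_push (h : Transfer e δ P P' L L') (hs : s ≠ 0) (ψ : ℝ → Vec) :
    GES (s * δ) (push e δ ψ) = GES s ψ := by
  simp only [GES, push, nrm_dMat_mulVec hs h.pos.ne']
  exact e.symm.toEquiv.iSup_comp (g := fun x => ENNReal.ofReal (nrm s (ψ x)))

theorem asMSE_push (h : Transfer e δ P P' L L') (hs : s ≠ 0) (ψ : ℝ → Vec) :
    asMSE P' (s * δ) r (push e δ ψ) = asMSE P s r ψ := by
  have hδ := h.pos.ne'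
  have hvar : ∀ i, asVar P' (push e δ ψ) i i = ![1, δ] i ^ 2 * asVar P ψ i i := by
    intro i
    simp only [asVar, Matrix.of_apply]
    rw [h.integral_eq, ← integral_const_mul]
    simp_rw [push_apply, dMat_mulVec_apply]
    congr 1
    ext x
    ring
  rw [asMSE, asMSE, h.GES_push hs, trace_dMat_mul (mul_ne_zero hs hδ), trace_dMat_mul hs, hvar,
    hvar]
  congr 3
  · simp
  · simp [field]

theorem isMBRE (h : Transfer e δ P P' L L') (hs : s ≠ 0) {ψ : ℝ → Vec} (hψ : IsMBRE P L s r ψ) :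
    IsMBRE P' L' (s * δ) r (push e δ ψ) := by
  refine ⟨h.isIF hψ.1, fun φ hφ => ?_⟩
  rw [← push_symm e h.pos.ne' φ, asBias, asBias, h.GES_push hs, h.GES_push hs]
  exact hψ.2 _ (h.symm.isIF hφ)

theorem isOMSE (h : Transfer e δ P P' L L') (hs : s ≠ 0) {ψ : ℝ → Vec} (hψ : IsOMSE P L s r ψ) :
    IsOMSE P' L' (s * δ) r (push e δ ψ) := by
  refine ⟨h.isIF hψ.1, fun φ hφ => ?_⟩
  rw [← push_symm e h.pos.ne' φ, h.asMSE_push hs, h.asMSE_push hs]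
  exact hψ.2 _ (h.symm.isIF hφ)

theorem integral_nrm_Y (h : Transfer e δ P P' L L') (hs : s ≠ 0) (A : Mat) (a : Vec)
    (f : ℝ → ℝ) :
    ∫ x, f (nrm (s * δ) (Y L' (dMat δ * A * dMat δ) (dMat δ *ᵥ a) x)) ∂P'
      = ∫ x, f (nrm s (Y L A a x)) ∂P := by
  rw [h.integral_eq]
  refine integral_congr_ae ?_
  filter_upwards [h.Y_eq A a] with x hx
  rw [hx, nrm_dMat_mulVec hs h.pos.ne']

theorem biasRatio_eq (h : Transfer e δ P P' L L') (hs : s ≠ 0) (A : Mat) (a : Vec) :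
    biasRatio P' L' (s * δ) (dMat δ * A * dMat δ) (dMat δ *ᵥ a) = biasRatio P L s A a := by
  have hδ := h.pos.ne'
  rw [biasRatio, biasRatio, h.integral_nrm_Y hs A a fun x => x, trace_dMat_mul hs,
    trace_dMat_mul (mul_ne_zero hs hδ), dMat_mul_mul_apply, dMat_mul_mul_apply]
  congr 2
  · simp
  · simp [field]

theorem mbreForm_eq (h : Transfer e δ P P' L L') (hs : s ≠ 0) (A : Mat) (a : Vec) (b : ℝ) :
    push e δ (mbreForm L s A a b)
      =ᵐ[P'] mbreForm L' (s * δ) (dMat δ * A * dMat δ) (dMat δ *ᵥ a) b := by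
  rw [EventuallyEq, h.ae_iff]
  filter_upwards [h.Y_eq A a] with x hx
  rw [push_apply, mbreForm, mbreForm, hx, nrm_dMat_mulVec hs h.pos.ne', Matrix.mulVec_smul]

theorem omseForm_eq (h : Transfer e δ P P' L L') (hs : s ≠ 0) (A : Mat) (a : Vec) (b : ℝ) :
    push e δ (omseForm L s A a b)
      =ᵐ[P'] omseForm L' (s * δ) (dMat δ * A * dMat δ) (dMat δ *ᵥ a) b := by
  rw [EventuallyEq, h.ae_iff]
  filter_upwards [h.Y_eq A a] with x hx
  rw [push_apply, omseForm, omseForm, hx, nrm_dMat_mulVec hs h.pos.ne', Matrix.mulVec_smul]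

theorem isMBREMult (h : Transfer e δ P P' L L') (hs : s ≠ 0) {A : Mat} {a : Vec} {b : ℝ}
    (hm : IsMBREMult P L s A a b) :
    IsMBREMult P' L' (s * δ) (dMat δ * A * dMat δ) (dMat δ *ᵥ a) b := by
  have hδ := h.pos.ne'
  refine ⟨hm.pos, hm.attained.trans (h.biasRatio_eq hs A a).symm, fun A' a' hpos => ?_,
    (h.isIF hm.isIF).congr (h.mbreForm_eq hs A a b)⟩
  -- Every competitor is the transform of a competitor in the original model.
  rw [← dMat_conj_inv hδ A', ← dMat_mulVec_inv hδ a'] at hpos ⊢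
  rw [h.biasRatio_eq hs]
  exact hm.max _ _ (by rwa [h.integral_nrm_Y hs _ _ fun x => x] at hpos)

theorem isOMSEMult (h : Transfer e δ P P' L L') (hs : s ≠ 0) {A : Mat} {a : Vec} {b : ℝ}
    (hm : IsOMSEMult P L s r A a b) :
    IsOMSEMult P' L' (s * δ) r (dMat δ * A * dMat δ) (dMat δ *ᵥ a) b :=
  ⟨hm.pos, hm.clip.trans (h.integral_nrm_Y hs A a fun t => max (t - b) 0).symm,
    (h.isIF hm.isIF).congr (h.omseForm_eq hs A a b)⟩

theorem isMBREMult_iff (h : Transfer e δ P P' L L') (hs : s ≠ 0) {A : Mat} {a : Vec} {b : ℝ} :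
    IsMBREMult P L s A a b ↔
      IsMBREMult P' L' (s * δ) (dMat δ * A * dMat δ) (dMat δ *ᵥ a) b := by
  have hδ := h.pos.ne'
  refine ⟨h.isMBREMult hs, fun hm => ?_⟩
  have := h.symm.isMBREMult (mul_ne_zero hs hδ) hm
  have hA := dMat_conj_inv (inv_ne_zero hδ) A
  have ha := dMat_mulVec_inv (inv_ne_zero hδ) a
  rw [inv_inv] at hA ha
  rwa [hA, ha, mul_assoc, mul_inv_cancel₀ hδ, mul_one] at this

theorem isOMSEMult_iff (h : Transfer e δ P P' L L') (hs : s ≠ 0) {A : Mat} {a : Vec} {b : ℝ} :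
    IsOMSEMult P L s r A a b ↔
      IsOMSEMult P' L' (s * δ) r (dMat δ * A * dMat δ) (dMat δ *ᵥ a) b := by
  have hδ := h.pos.ne'
  refine ⟨h.isOMSEMult hs, fun hm => ?_⟩
  have := h.symm.isOMSEMult (mul_ne_zero hs hδ) hm
  have hA := dMat_conj_inv (inv_ne_zero hδ) A
  have ha := dMat_mulVec_inv (inv_ne_zero hδ) a
  rw [inv_inv] at hA ha
  rwa [hA, ha, mul_assoc, mul_inv_cancel₀ hδ, mul_one] at this

end Transfer

end GPD

end

/-! ### Scale structure of the generalized Pareto model -/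

noncomputable section

namespace GPD

theorem measurableSet_supp (ξ β : ℝ) : MeasurableSet (supp ξ β) := by
  rw [supp]
  split_ifs
  · exact measurableSet_Ioc
  · exact measurableSet_Ici

theorem measurable_density (ξ β : ℝ) : Measurable (density ξ β) := by
  unfold density
  refine Measurable.ite (measurableSet_supp ξ β) ?_ measurable_const
  split_ifs <;> fun_prop

theorem mem_supp {ξ β x : ℝ} (hβ : 0 < β) (hx : 0 < x) (hw : 0 < 1 + ξ * (x / β)) :
    x ∈ supp ξ β := by
  rw [supp]
  split_ifs with h
  · refine ⟨hx, ?_⟩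
    rw [le_div_iff_of_neg h]
    field_simp at hw
    linarith
  · exact hx.le

theorem one_add_pos_of_mem_supp {ξ β x : ℝ} (hβ : 0 < β) (h : x ∈ supp ξ β) (h0 : x ≠ 0)
    (h1 : x ≠ -β / ξ) : 0 < x ∧ 0 < 1 + ξ * (x / β) := by
  rw [supp] at h
  split_ifs at h with hξ
  · refine ⟨h.1, ?_⟩
    have := lt_of_le_of_ne h.2 h1
    rw [lt_div_iff_of_neg hξ] at this
    field_simp
    linarith
  · have hx : 0 < x := lt_of_le_of_ne h h0.symm
    have : 0 ≤ ξ := not_lt.1 hξ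
    exact ⟨hx, by positivity⟩

theorem density_nonneg {β : ℝ} (ξ : ℝ) (hβ : 0 < β) (x : ℝ) (h1 : x ≠ -β / ξ) (h0 : x ≠ 0) :
    0 ≤ density ξ β x := by
  rw [density]
  split_ifs with h h2
  · positivity
  · have := (one_add_pos_of_mem_supp hβ h h0 h1).2
    positivity
  · exact le_rfl

/-- The endpoints of the support are Lebesgue null, so all later arguments may stay in its interior.
-/
theorem ae_gpd (ξ : ℝ) {β : ℝ} (hβ : 0 < β) :
    ∀ᵐ x ∂gpd ξ β, 0 < x ∧ 0 < 1 + ξ * (x / β) := by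
  rw [gpd, ae_withDensity_iff (measurable_density ξ β).ennreal_ofReal]
  filter_upwards [Measure.ae_ne volume 0, Measure.ae_ne volume (-β / ξ)] with x h0 h1 hx
  refine one_add_pos_of_mem_supp hβ ?_ h0 h1
  by_contra h
  simp [density, h] at hx

theorem density_scale {β : ℝ} (ξ : ℝ) (hβ : 0 < β) (x : ℝ) :
    β * density ξ β (β * x) = density ξ 1 x := by
  have hmem : β * x ∈ supp ξ β ↔ x ∈ supp ξ 1 := by
    rw [supp, supp]
    split_ifs with h
    · rw [Set.mem_Ioc, Set.mem_Ioc, le_div_iff_of_neg h, le_div_iff_of_neg h, mul_assoc,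
        ← mul_neg_one β, mul_le_mul_iff_right₀ hβ, mul_pos_iff_of_pos_left hβ]
    · rw [Set.mem_Ici, Set.mem_Ici, mul_nonneg_iff_of_pos_left hβ]
  rw [density, density]
  simp only [mul_div_cancel_left₀ _ hβ.ne', div_one, inv_one, one_mul]
  by_cases h : x ∈ supp ξ 1
  · rw [if_pos h, if_pos (hmem.2 h)]
    split_ifs <;> rw [mul_inv_cancel_left₀ hβ.ne']
  · rw [if_neg h, if_neg (mt hmem.1 h), mul_zero]

theorem gpd_map_mul (ξ : ℝ) {β : ℝ} (hβ : 0 < β) :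
    gpd ξ β = (gpd ξ 1).map (MeasurableEquiv.mulLeft₀ β hβ.ne') := by
  ext t ht
  have hmeas : Measurable fun x => ENNReal.ofReal (density ξ β x) :=
    (measurable_density ξ β).ennreal_ofReal
  rw [MeasurableEquiv.map_apply, gpd, gpd, withDensity_apply _ ht,
    withDensity_apply _ ((MeasurableEquiv.measurable _) ht)]
  -- Lebesgue measure is `|β|` times its image under multiplication by `β`; this factor is absorbed
  -- by `density_scale`.
  nth_rw 1 [← Real.smul_map_volume_mul_left hβ.ne']
  rw [Measure.restrict_smul, lintegral_smul_measure, setLIntegral_map ht hmeas (by fun_prop),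
    smul_eq_mul, ← lintegral_const_mul _ (by exact hmeas.comp (measurable_const_mul β))]
  refine lintegral_congr fun x => ?_
  rw [← density_scale ξ hβ, ENNReal.ofReal_mul hβ.le, abs_of_pos hβ]

theorem score_scale (ξ : ℝ) {β : ℝ} (hβ : 0 < β) (x : ℝ) :
    score ξ β (β * x) = dMat β⁻¹ *ᵥ score ξ 1 x := by
  ext i
  rw [dMat_mulVec_apply]
  fin_cases i
  · simp [score, hβ.ne']
  · simp only [score, mul_div_cancel_left₀ _ hβ.ne']
    simp
    ring

theorem transfer_scale (ξ : ℝ) {β : ℝ} (hβ : 0 < β) :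
    Transfer (MeasurableEquiv.mulLeft₀ β hβ.ne') β (gpd ξ 1) (gpd ξ β) (score ξ 1) (score ξ β) :=
  ⟨hβ, gpd_map_mul ξ hβ, ae_of_all _ fun x => score_scale ξ hβ x⟩

/-! The log-scale model. -/

/-- The exponent of the generalized Pareto density, as a function of the shape. -/
def logShape (s z : ℝ) : ℝ := if s = 0 then -z else (-1 / s - 1) * Real.log (1 + s * z)

theorem log_density {ξ β x : ℝ} (hβ : 0 < β) (hx : 0 < x) (hw : 0 < 1 + ξ * (x / β)) :
    Real.log (density ξ β x) = -Real.log β + logShape ξ (x / β) := by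
  rw [density, if_pos (mem_supp hβ hx hw), logShape]
  split_ifs
  · rw [Real.log_mul (by positivity) (by positivity), Real.log_inv, Real.log_exp]
  · rw [Real.log_mul (by positivity) (by positivity), Real.log_inv, Real.log_rpow hw]

/-- From `log (1 + u) = u - u²/2 + O(u³)` at `u = s z`, divided by `s`. It handles the shape
derivative at `ξ = 0`. -/
theorem hasDerivAt_log_div (z : ℝ) :
    HasDerivAt (fun s => if s = 0 then z else Real.log (1 + s * z) / s) (-z ^ 2 / 2) 0 := by
  rw [hasDerivAt_iff_isLittleO]
  refine Asymptotics.IsBigO.trans_isLittleO (g := fun s : ℝ => s ^ 2) ?_ ?_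
  · refine Asymptotics.IsBigO.of_bound (2 * |z| ^ 3) ?_
    have hc : Continuous fun s : ℝ => |s * z| := by fun_prop
    have : ∀ᶠ s in 𝓝 (0 : ℝ), |s * z| < 1 / 2 :=
      hc.continuousAt.eventually (gt_mem_nhds (by simp))
    filter_upwards [this] with s hs
    rcases eq_or_ne s 0 with rfl | h0
    · simp
    have h1 := Real.abs_log_sub_add_sum_range_le (x := -(s * z)) (by rw [abs_neg]; linarith) 2
    rw [abs_neg, sub_neg_eq_add] at h1
    simp only [Finset.sum_range_succ, Finset.sum_range_zero] at h1
    have h2 : |s * z| ^ (2 + 1) / (1 - |s * z|) ≤ 2 * |s * z| ^ 3 := by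
      rw [div_le_iff₀ (by linarith)]
      have : 0 ≤ |s * z| ^ 3 := by positivity
      have h2 : 0 ≤ |s * z| ^ 3 * (1 / 2 - |s * z|) := mul_nonneg this (by linarith)
      norm_num only
      linarith
    have h3 := h1.trans h2
    simp only [h0, if_false, if_true, sub_zero, smul_eq_mul, Real.norm_eq_abs]
    have h4 : Real.log (1 + s * z) / s - z - s * (-z ^ 2 / 2)
        = (Real.log (1 + s * z) - s * z + (s * z) ^ 2 / 2) / s := by
      field_simp
      ring
    rw [h4, abs_div, div_le_iff₀ (abs_pos.2 h0)]
    rw [abs_mul s z] at h3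
    rw [abs_pow]
    calc _ ≤ 2 * (|s| * |z|) ^ 3 := by
          refine le_trans (le_of_eq ?_) h3
          congr 1
          push_cast
          ring
      _ = _ := by ring
  · simpa using Asymptotics.isLittleO_pow_id (𝕜 := ℝ) one_lt_two

theorem hasDerivAt_logShape {ξ z : ℝ} (hw : 0 < 1 + ξ * z) :
    HasDerivAt (fun s => logShape s z)
      (if ξ = 0 then z ^ 2 / 2 - z
        else 1 / ξ ^ 2 * Real.log (1 + ξ * z) - (ξ + 1) / ξ * (z / (1 + ξ * z))) ξ := by
  split_ifs with h
  · subst h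
    -- `logShape s z` is `-(1 + s)` times this extended quotient.
    have h1 := hasDerivAt_log_div z
    have h2 := ((hasDerivAt_id (0 : ℝ)).const_add 1).neg.mul h1
    refine (h2.congr_of_eventuallyEq (Eventually.of_forall fun s => ?_)).congr_deriv ?_
    · simp only [logShape, Pi.mul_apply, Pi.neg_apply, id]
      split_ifs with h
      · simp [h]
      · field_simp
        ring
    · simp
      ring
  · have h1 : HasDerivAt (fun s : ℝ => Real.log (1 + s * z)) (z / (1 + ξ * z)) ξ := by
      have := (((hasDerivAt_id ξ).mul_const z).const_add 1).log hw.ne'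
      simpa using this
    have h2 : HasDerivAt (fun s : ℝ => -1 / s - 1) (1 / ξ ^ 2) ξ := by
      have := (((hasDerivAt_id ξ).inv h).neg).sub_const 1
      refine (this.congr_of_eventuallyEq (Eventually.of_forall fun s => ?_)).congr_deriv ?_
      · simp [neg_div]
      · simp [neg_div]
    have h3 := h2.mul h1
    refine (h3.congr_of_eventuallyEq ?_).congr_deriv ?_
    · filter_upwards [isOpen_ne.mem_nhds h] with s hs
      simp only [logShape, Pi.mul_apply]
      rw [if_neg hs]
    · field_simp
      ring

theorem hasDerivAt_logShape_scale {ξ t x : ℝ} (hw : 0 < 1 + ξ * (x / Real.exp t)) :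
    HasDerivAt (fun u => logShape ξ (x / Real.exp u))
      ((ξ + 1) * (x / Real.exp t / (1 + ξ * (x / Real.exp t)))) t := by
  have h1 : HasDerivAt (fun u => x / Real.exp u) (-(x / Real.exp t)) t := by
    have := (((hasDerivAt_id t).neg).exp).const_mul x
    refine (this.congr_of_eventuallyEq (Eventually.of_forall fun u => ?_)).congr_deriv ?_
    · simp [Real.exp_neg, div_eq_mul_inv]
    · simp [Real.exp_neg, div_eq_mul_inv]
  unfold logShape
  split_ifs with h
  · subst h
    refine h1.neg.congr_deriv ?_
    simp
  · have h2 := ((h1.const_mul ξ).const_add 1).log hw.ne'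
    refine (h2.const_mul (-1 / ξ - 1)).congr_deriv ?_
    field_simp
    ring

/-- The condition `1 + ξ x / exp t > 0` is open in both parameters, so the closed form of the log
density may be differentiated; the chain rule for `exp t` produces the matrix. -/
theorem scoreLog_eq {ξ t x : ℝ} (hx : 0 < x) (hw : 0 < 1 + ξ * (x / Real.exp t)) :
    scoreLog ξ t x = dMat (Real.exp t) *ᵥ score ξ (Real.exp t) x := by
  have hβ := Real.exp_pos t
  have h0 : HasDerivAt (fun s => Real.log (density s (Real.exp t) x))
      (score ξ (Real.exp t) x 0) ξ := by
    refine ((hasDerivAt_logShape hw).const_add (-Real.log (Real.exp t))).congr_of_eventuallyEq ?_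
    have hc : Continuous fun s => 1 + s * (x / Real.exp t) := by fun_prop
    filter_upwards [hc.continuousAt.eventually (lt_mem_nhds hw)] with s hs
    exact log_density hβ hx hs
  have h1 : HasDerivAt (fun u => Real.log (density ξ (Real.exp u) x))
      (Real.exp t * score ξ (Real.exp t) x 1) t := by
    have h2 := (hasDerivAt_id t).neg.add (hasDerivAt_logShape_scale hw)
    refine (h2.congr_of_eventuallyEq ?_).congr_deriv ?_
    · have hc : Continuous fun u => 1 + ξ * (x / Real.exp u) := by fun_prop (disch := simp)
      filter_upwards [hc.continuousAt.eventually (lt_mem_nhds hw)] with u hu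
      rw [log_density (Real.exp_pos u) hx hu, Real.log_exp]
      rfl
    · simp [score]
      field_simp
  ext i
  rw [dMat_mulVec_apply]
  fin_cases i
  · simpa [scoreLog] using h0.deriv
  · simpa [scoreLog] using h1.deriv

/-- Observations stay fixed; the factor `β⁻¹` turns the norm `n_β` into the Euclidean norm. -/
theorem transfer_log (ξ : ℝ) {β : ℝ} (hβ : 0 < β) :
    Transfer (MeasurableEquiv.refl ℝ) β⁻¹ (gpd ξ β) (gpdLog ξ (Real.log β)) (score ξ β)
      (scoreLog ξ (Real.log β)) := by
  refine ⟨inv_pos.2 hβ, ?_, ?_⟩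
  · rw [gpdLog, Real.exp_log hβ, show ⇑(MeasurableEquiv.refl ℝ) = id from rfl,
      Measure.map_id]
  · filter_upwards [ae_gpd ξ hβ] with x hx
    rw [MeasurableEquiv.refl_apply, scoreLog_eq hx.1 (by rw [Real.exp_log hβ]; exact hx.2),
      Real.exp_log hβ, inv_inv]

end GPD

end

/-! ### Integrability and nondegeneracy of the scores -/

noncomputable section

namespace GPD

theorem measurable_score (ξ β : ℝ) (i : Fin 2) : Measurable fun x => score ξ β x i := by
  fin_cases i
  · simp only [score, Fin.zero_eta, cons_val_zero]
    split_ifs <;> fun_prop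
  · simp only [score, Fin.mk_one, cons_val_one, cons_val_fin_one]
    fun_prop

theorem isOpen_interior_supp (ξ : ℝ) : IsOpen {x : ℝ | 0 < x ∧ 0 < 1 + ξ * x} :=
  (isOpen_lt continuous_const continuous_id).inter
    (isOpen_lt continuous_const (continuous_const.add (continuous_const.mul continuous_id)))

theorem integrable_gpd_of_bound {ξ : ℝ} {f g : ℝ → ℝ} (hf : Measurable f)
    (hg : IntegrableOn g {x | 0 < x ∧ 0 < 1 + ξ * x})
    (h : ∀ x, 0 < x → 0 < 1 + ξ * x → |f x| * density ξ 1 x ≤ g x) : Integrable f (gpd ξ 1) := by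
  have hm := (isOpen_interior_supp ξ).measurableSet
  rw [gpd, integrable_withDensity_iff (measurable_density ξ 1).ennreal_ofReal
    (ae_of_all _ fun x => ENNReal.ofReal_lt_top)]
  refine ((integrable_indicator_iff hm).2 hg).mono'
    (hf.mul (measurable_density ξ 1).ennreal_ofReal.ennreal_toReal).aestronglyMeasurable ?_
  filter_upwards [Measure.ae_ne volume 0, Measure.ae_ne volume (-1 / ξ)] with x h0 h1
  rw [ENNReal.toReal_ofReal (density_nonneg ξ one_pos x h1 h0), norm_mul, Real.norm_eq_abs,
    Real.norm_of_nonneg (density_nonneg ξ one_pos x h1 h0)]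
  by_cases hx : x ∈ supp ξ 1
  · have := one_add_pos_of_mem_supp one_pos hx h0 h1
    rw [div_one] at this
    rw [Set.indicator_of_mem (show x ∈ {x : ℝ | 0 < x ∧ 0 < 1 + ξ * x} from this)]
    exact h x this.1 this.2
  · have hx' : x ∉ {x : ℝ | 0 < x ∧ 0 < 1 + ξ * x} := fun hmem =>
      hx (mem_supp one_pos hmem.1 (by rw [div_one]; exact hmem.2))
    rw [Set.indicator_of_notMem hx', density, if_neg hx, mul_zero]

theorem density_eq {ξ x : ℝ} (hx : 0 < x) (hw : 0 < 1 + ξ * x) :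
    density ξ 1 x = if ξ = 0 then Real.exp (-x) else (1 + ξ * x) ^ (-1 / ξ - 1) := by
  rw [density, if_pos (mem_supp one_pos hx (by rwa [div_one]))]
  simp

/-- If a function `h` with `h * density ≤ g`, `g` integrable, bounds the scores and the constant
one up to a factor, then all of these are integrable. -/
theorem integrable_score_of_bound {ξ C : ℝ} {h g : ℝ → ℝ}
    (hg : IntegrableOn g {x | 0 < x ∧ 0 < 1 + ξ * x})
    (hgh : ∀ x, 0 < x → 0 < 1 + ξ * x → h x * density ξ 1 x ≤ g x) (hC : 0 ≤ C)
    (h1 : ∀ x, 0 < x → 0 < 1 + ξ * x → 1 ≤ C * h x)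
    (hs : ∀ i x, 0 < x → 0 < 1 + ξ * x → |score ξ 1 x i| ≤ C * h x) :
    IsFiniteMeasure (gpd ξ 1) ∧ ∀ i, Integrable (fun x => score ξ 1 x i) (gpd ξ 1) := by
  have key : ∀ f : ℝ → ℝ, Measurable f →
      (∀ x, 0 < x → 0 < 1 + ξ * x → |f x| ≤ C * h x) → Integrable f (gpd ξ 1) := by
    intro f hf hfb
    refine integrable_gpd_of_bound hf (hg.const_mul C) fun x hx hw => ?_
    have h0 : 0 ≤ density ξ 1 x := by
      rw [density_eq hx hw]
      split_ifs <;> positivity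
    calc _ ≤ C * h x * density ξ 1 x := by gcongr; exact hfb x hx hw
      _ ≤ _ := by rw [mul_assoc]; exact mul_le_mul_of_nonneg_left (hgh x hx hw) hC
  refine ⟨?_, fun i => key _ (measurable_score ξ 1 i) (hs i)⟩
  have := key (fun _ => 1) measurable_const (by simpa using h1)
  simpa [integrable_const_iff] using this

theorem score_apply_zero {ξ : ℝ} (h : ξ ≠ 0) (x : ℝ) :
    score ξ 1 x 0 = 1 / ξ ^ 2 * Real.log (1 + ξ * x) - (ξ + 1) / ξ * (x / (1 + ξ * x)) := by
  simp [score, h]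

theorem score_apply_one (ξ x : ℝ) : score ξ 1 x 1 = -1 + (ξ + 1) * (x / (1 + ξ * x)) := by
  simp [score]

theorem abs_score_le {ξ x B D : ℝ} (h : ξ ≠ 0) (hB : |Real.log (1 + ξ * x)| ≤ B)
    (hD : |x / (1 + ξ * x)| ≤ D) (h1 : 1 ≤ B) (i : Fin 2) :
    |score ξ 1 x i| ≤ (1 + 1 / ξ ^ 2) * B + (|(ξ + 1) / ξ| + |ξ + 1|) * D := by
  have h3 : 0 ≤ 1 / ξ ^ 2 * B := by positivity
  have hD0 : 0 ≤ D := (abs_nonneg _).trans hD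
  have e1 : |(ξ + 1) / ξ * (x / (1 + ξ * x))| ≤ |(ξ + 1) / ξ| * D := by
    rw [abs_mul]; gcongr
  have e2 : |(ξ + 1) * (x / (1 + ξ * x))| ≤ |ξ + 1| * D := by
    rw [abs_mul]; gcongr
  have e3 : |1 / ξ ^ 2 * Real.log (1 + ξ * x)| ≤ 1 / ξ ^ 2 * B := by
    rw [abs_mul, abs_of_nonneg (by positivity : (0 : ℝ) ≤ 1 / ξ ^ 2)]; gcongr
  have e4 : 0 ≤ |(ξ + 1) / ξ| * D := by positivity
  have e5 : 0 ≤ |ξ + 1| * D := by positivity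
  fin_cases i
  · simp only [Fin.zero_eta, score_apply_zero h]
    refine (abs_sub _ _).trans ?_
    linarith
  · simp only [Fin.mk_one, score_apply_one]
    refine (abs_add_le _ _).trans ?_
    rw [abs_neg, abs_one]
    linarith

theorem integrable_score_of_pos {ξ : ℝ} (h : 0 < ξ) :
    IsFiniteMeasure (gpd ξ 1) ∧ ∀ i, Integrable (fun x => score ξ 1 x i) (gpd ξ 1) := by
  -- With `w = 1 + ξ x` the density is `w ^ (-2ε - 1)`: the factor `w ^ ε` dominates the logarithm
  -- and still leaves the integrable `w ^ (-ε - 1)`.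
  set ε : ℝ := 1 / (2 * ξ) with hε
  have hε0 : 0 < ε := by positivity
  have h1ε : ∀ x, 0 < x → 1 ≤ (1 + ξ * x) ^ ε := fun x hx =>
    Real.one_le_rpow (by nlinarith) hε0.le
  set B : ℝ := 1 + 1 / ε with hB
  set D : ℝ := 1 / ξ with hD
  refine integrable_score_of_bound (h := fun x => (1 + ξ * x) ^ ε)
    (g := fun x => (1 + ξ * x) ^ (-ε - 1))
    (C := 1 + ((1 + 1 / ξ ^ 2) * B + (|(ξ + 1) / ξ| + |ξ + 1|) * D))
    ?_ (fun x hx hw => ?_) (by positivity) (fun x hx hw => ?_) fun i x hx hw => ?_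
  · have hint : IntegrableOn (fun x : ℝ => ξ ^ (-ε - 1) * (x + 1 / ξ) ^ (-ε - 1)) (Set.Ioi 0) :=
      (integrableOn_add_rpow_Ioi_of_lt (by linarith) (by simpa using h)).const_mul _
    refine (hint.mono_set fun x hx => hx.1).congr_fun (fun x hx => ?_) ?_
    · have hx0 : 0 < x := hx.1
      simp only
      rw [← Real.mul_rpow h.le (by positivity)]
      congr 1
      field_simp
      ring
    · exact (isOpen_interior_supp ξ).measurableSet
  · rw [density_eq hx hw, if_neg h.ne', ← Real.rpow_add hw]
    refine le_of_eq ?_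
    congr 1
    rw [hε]
    field_simp
    ring
  · have h2 := h1ε x hx
    have : 0 ≤ (1 + 1 / ξ ^ 2) * B + (|(ξ + 1) / ξ| + |ξ + 1|) * D := by positivity
    nlinarith
  · have h2 := h1ε x hx
    have hlog : |Real.log (1 + ξ * x)| ≤ B * (1 + ξ * x) ^ ε := by
      rw [abs_of_nonneg (Real.log_nonneg (by nlinarith))]
      have := Real.log_le_rpow_div hw.le hε0
      rw [hB, add_mul, one_mul, one_div_mul_eq_div]
      linarith
    have hv : |x / (1 + ξ * x)| ≤ D * (1 + ξ * x) ^ ε := by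
      rw [abs_of_nonneg (by positivity)]
      have h3 : x / (1 + ξ * x) ≤ D := by
        rw [hD, div_le_div_iff₀ hw h]
        linarith
      have h4 : 0 ≤ D := by positivity
      nlinarith
    have hB1 : 1 ≤ B * (1 + ξ * x) ^ ε := by
      have : 1 ≤ B := by rw [hB]; simpa using hε0.le
      nlinarith
    refine (abs_score_le h.ne' hlog hv hB1 i).trans ?_
    nlinarith

theorem integrable_score_of_neg {ξ : ℝ} (h : ξ < 0) (hξ : -1 / 2 < ξ) :
    IsFiniteMeasure (gpd ξ 1) ∧ ∀ i, Integrable (fun x => score ξ 1 x i) (gpd ξ 1) := by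
  have hw1 : ∀ x, 0 < x → 1 + ξ * x ≤ 1 := fun x hx => by nlinarith
  have hinv : ∀ x, 0 < x → 0 < 1 + ξ * x → 1 ≤ (1 + ξ * x)⁻¹ := fun x hx hw =>
    (one_le_inv₀ hw).2 (hw1 x hx)
  have hξ' : 0 < -ξ := by linarith
  set D : ℝ := 1 / (-ξ) with hD
  have hD0 : 0 < D := by positivity
  refine integrable_score_of_bound (h := fun x => (1 + ξ * x)⁻¹) (g := fun _ => 1)
    (C := 1 + ((1 + 1 / ξ ^ 2) * 1 + (|(ξ + 1) / ξ| + |ξ + 1|) * D))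
    ?_ (fun x hx hw => ?_) (by positivity) (fun x hx hw => ?_) fun i x hx hw => ?_
  · have hsub : {x | 0 < x ∧ 0 < 1 + ξ * x} ⊆ Set.Icc 0 D := by
      rintro x ⟨hx, hw⟩
      refine ⟨hx.le, ?_⟩
      rw [hD, le_div_iff₀ hξ']
      linarith
    exact (integrableOn_const (by simp)).mono_set hsub
  · rw [density_eq hx hw, if_neg h.ne, ← Real.rpow_neg_one, ← Real.rpow_add hw]
    refine Real.rpow_le_one hw.le (hw1 x hx) ?_
    -- This is where `ξ > -1/2` enters: the density times `w⁻¹` is `w ^ (-1/ξ - 2)`, bounded on the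
    -- bounded support.
    have : 2 ≤ -1 / ξ := by
      rw [le_div_iff_of_neg h]
      linarith
    linarith
  · have h2 := hinv x hx hw
    have : 0 ≤ (1 + 1 / ξ ^ 2) * 1 + (|(ξ + 1) / ξ| + |ξ + 1|) * D := by positivity
    nlinarith
  · have h2 := hinv x hx hw
    have hlog : |Real.log (1 + ξ * x)| ≤ (1 + ξ * x)⁻¹ := by
      rw [abs_of_nonpos (Real.log_nonpos hw.le (hw1 x hx)), ← Real.log_inv]
      exact (Real.log_le_sub_one_of_pos (by positivity)).trans (by linarith)
    have hv : |x / (1 + ξ * x)| ≤ D * (1 + ξ * x)⁻¹ := by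
      rw [abs_of_nonneg (by positivity), div_eq_mul_inv]
      gcongr
      rw [hD, le_div_iff₀ hξ']
      linarith
    refine (abs_score_le h.ne hlog hv h2 i).trans ?_
    nlinarith

theorem integrable_score_zero :
    IsFiniteMeasure (gpd 0 1) ∧ ∀ i, Integrable (fun x => score 0 1 x i) (gpd 0 1) := by
  -- Four times this quadratic is `4 + 2x + x²/2`, which dominates both scores.
  have hexp : ∀ x : ℝ, 0 < x → 1 + x / 2 + (x / 2) ^ 2 / 2 ≤ Real.exp (x / 2) := fun x hx =>
    Real.quadratic_le_exp_of_nonneg (by positivity)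
  refine integrable_score_of_bound (h := fun x => Real.exp (x / 2))
    (g := fun x => Real.exp (-(1 / 2) * x)) (C := 4)
    ?_ (fun x hx hw => ?_) (by positivity) (fun x hx hw => ?_) fun i x hx hw => ?_
  · exact (exp_neg_integrableOn_Ioi 0 (by norm_num)).mono_set fun x hx => hx.1
  · rw [density_eq hx hw, if_pos rfl, ← Real.exp_add]
    refine le_of_eq ?_
    congr 1
    ring
  · nlinarith [hexp x hx]
  · have h2 := hexp x hx
    fin_cases i
    · simp only [score, div_one, Fin.zero_eta, cons_val_zero, if_true]
      rw [abs_le]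
      constructor <;> nlinarith
    · simp only [score_apply_one, Fin.mk_one]
      norm_num
      rw [abs_le]
      constructor <;> nlinarith

theorem integrable_score {ξ : ℝ} (hξ : -1 / 2 < ξ) :
    IsFiniteMeasure (gpd ξ 1) ∧ ∀ i, Integrable (fun x => score ξ 1 x i) (gpd ξ 1) := by
  rcases lt_trichotomy ξ 0 with h | rfl | h
  · exact integrable_score_of_neg h hξ
  · exact integrable_score_zero
  · exact integrable_score_of_pos h

theorem gpd_ne_zero (ξ : ℝ) : gpd ξ 1 ≠ 0 := by
  intro h0
  rw [gpd, withDensity_eq_zero_iff (measurable_density ξ 1).ennreal_ofReal.aemeasurable] at h0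
  set J : Set ℝ := {x | 0 < x ∧ 0 < 1 + ξ * x} with hJ
  have hopen : IsOpen J := isOpen_interior_supp ξ
  have hJ0 : volume J = 0 := by
    refine measure_mono_null (fun x hx => ?_) h0
    have : 0 < density ξ 1 x := by
      have hw : 0 < 1 + ξ * x := hx.2
      rw [density_eq hx.1 hx.2]
      split_ifs <;> positivity
    simpa using this
  rw [hopen.measure_eq_zero_iff volume] at hJ0
  -- A point of the interior for either sign of `ξ`, since `|ξ| / (1 + |ξ|) < 1`.
  have hmem : 1 / (1 + |ξ|) ∈ J := by
    refine ⟨by positivity, ?_⟩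
    have := neg_abs_le ξ
    field_simp
    linarith
  rw [hJ0] at hmem
  exact hmem

theorem hasDerivAt_score_zero {ξ x : ℝ} (hw : 0 < 1 + ξ * x) :
    HasDerivAt (fun x => score ξ 1 x 0) ((x - 1) / (1 + ξ * x) ^ 2) x := by
  have h1 : HasDerivAt (fun x => 1 + ξ * x) ξ x := by
    simpa using ((hasDerivAt_id x).const_mul ξ).const_add 1
  rcases eq_or_ne ξ 0 with rfl | h
  · have h2 : HasDerivAt (fun x : ℝ => x ^ 2 / 2 - x) (x - 1) x := by
      have := ((hasDerivAt_pow 2 x).div_const 2).sub (hasDerivAt_id x)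
      refine this.congr_deriv ?_
      simp
    refine (h2.congr_of_eventuallyEq (Eventually.of_forall fun y => ?_)).congr_deriv (by simp)
    simp [score]
  · have h2 := ((h1.log hw.ne').const_mul (1 / ξ ^ 2)).sub
      (((hasDerivAt_id x).div h1 hw.ne').const_mul ((ξ + 1) / ξ))
    refine (h2.congr_of_eventuallyEq (Eventually.of_forall fun y => ?_)).congr_deriv ?_
    · simp [score_apply_zero h]
    · simp only [id]
      field_simp
      ring

theorem hasDerivAt_score_one {ξ x : ℝ} (hw : 0 < 1 + ξ * x) :
    HasDerivAt (fun x => score ξ 1 x 1) ((ξ + 1) / (1 + ξ * x) ^ 2) x := by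
  have h1 : HasDerivAt (fun x => 1 + ξ * x) ξ x := by
    simpa using ((hasDerivAt_id x).const_mul ξ).const_add 1
  have h2 := (((hasDerivAt_id x).div h1 hw.ne').const_mul (ξ + 1)).const_add (-1)
  refine (h2.congr_of_eventuallyEq (Eventually.of_forall fun y => ?_)).congr_deriv ?_
  · simp [score_apply_one]
  · simp only [id]
    field_simp
    ring

/-- A zero with nonzero derivative is isolated, and the isolated points of a set of reals are
countable. -/
theorem countable_zeros_of_hasDerivAt {f f' : ℝ → ℝ} {s : Set ℝ}
    (h : ∀ x ∈ s, HasDerivAt f (f' x) x) (h0 : ∀ x ∈ s, f x = 0) (h' : ∀ x ∈ s, f' x ≠ 0) :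
    s.Countable := by
  refine (countable_setOfPred_isolated_right_within (s := s)).mono fun x hx => ?_
  refine Set.mem_sep hx ?_
  have hev := (h x hx).eventually_ne (c := 0) (h' x hx)
  rw [← Filter.empty_mem_iff_bot]
  have hle : 𝓝[s ∩ Set.Ioi x] x ≤ 𝓝[≠] x := nhdsWithin_mono _ fun y hy => hy.2.ne'
  filter_upwards [hle hev, self_mem_nhdsWithin] with y hy hys
  exact hy (h0 y hys.1)

theorem countable_zeros_score {ξ c₁ c₂ c₀ : ℝ} (hξ : ξ + 1 ≠ 0)
    (hc : c₁ ≠ 0 ∨ c₂ ≠ 0 ∨ c₀ ≠ 0) :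
    {x | 0 < 1 + ξ * x ∧ c₁ * score ξ 1 x 0 + c₂ * score ξ 1 x 1 - c₀ = 0}.Countable := by
  by_cases h0 : c₁ = 0 ∧ c₂ = 0
  · obtain ⟨rfl, rfl⟩ := h0
    have : c₀ ≠ 0 := by simpa using hc
    simp [this]
  -- The numerator of the derivative over the common denominator `(1 + ξ x)²`; it is affine in `x`
  -- and, as `ξ ≠ -1`, not identically zero.
  set Z : Set ℝ := {x | c₁ * (x - 1) + c₂ * (ξ + 1) = 0} with hZ
  have hZs : Z.Subsingleton := by
    intro x hx y hy
    simp only [hZ, Set.mem_ofPred_eq] at hx hy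
    have hc1 : c₁ ≠ 0 := by
      rintro rfl
      refine h0 ⟨rfl, ?_⟩
      simpa [hξ] using hx
    have : c₁ * (x - y) = 0 := by linarith
    rcases mul_eq_zero.1 this with h | h
    · exact absurd h hc1
    · linarith
  rw [← Set.sdiff_union_inter (Set.ofPred _) Z]
  refine Set.Countable.union ?_ (hZs.anti Set.inter_subset_right).countable
  refine countable_zeros_of_hasDerivAt
    (f := fun x => c₁ * score ξ 1 x 0 + c₂ * score ξ 1 x 1 - c₀)
    (f' := fun x => c₁ * ((x - 1) / (1 + ξ * x) ^ 2) + c₂ * ((ξ + 1) / (1 + ξ * x) ^ 2))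
    (fun x hx => (((hasDerivAt_score_zero hx.1.1).const_mul c₁).add
      ((hasDerivAt_score_one hx.1.1).const_mul c₂)).sub_const c₀)
    (fun x hx => hx.1.2) fun x hx h => hx.2 ?_
  have hw : 0 < 1 + ξ * x := hx.1.1
  rw [hZ, Set.mem_ofPred_eq]
  rw [mul_div_assoc', mul_div_assoc', ← add_div, div_eq_zero_iff] at h
  exact h.resolve_right (by positivity)

theorem regular_gpd_one {ξ : ℝ} (hξ : -1 / 2 < ξ) : Regular (gpd ξ 1) (score ξ 1) := by
  refine ⟨(integrable_score hξ).1, gpd_ne_zero ξ, (integrable_score hξ).2, fun A a hA => ?_⟩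
  obtain ⟨i, hi⟩ : ∃ i, A i 0 ≠ 0 ∨ A i 1 ≠ 0 ∨ a i ≠ 0 := by
    by_contra! hcon
    refine hA.elim (fun h => h ?_) fun h => h ?_
    · ext i j
      fin_cases j
      · exact (hcon i).1
      · exact (hcon i).2.1
    · ext i
      exact (hcon i).2.2
  have hnull := (countable_zeros_score (by linarith : ξ + 1 ≠ 0) hi).measure_zero volume
  have hnull' := withDensity_absolutelyContinuous volume
    (fun x => ENNReal.ofReal (density ξ 1 x)) hnull
  filter_upwards [ae_gpd ξ one_pos, compl_mem_ae_iff.2 hnull'] with x hx hx' h0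
  rw [div_one] at hx
  refine hx' ⟨hx.2, ?_⟩
  rw [← Y_apply, h0, Pi.zero_apply]

theorem regular_gpd {ξ β : ℝ} (hξ : -1 / 2 < ξ) (hβ : 0 < β) : Regular (gpd ξ β) (score ξ β) :=
  (transfer_scale ξ hβ).regular (regular_gpd_one hξ)

theorem regular_gpdLog {ξ β : ℝ} (hξ : -1 / 2 < ξ) (hβ : 0 < β) :
    Regular (gpdLog ξ (Real.log β)) (scoreLog ξ (Real.log β)) :=
  (transfer_log ξ hβ).regular (regular_gpd hξ hβ)

end GPD

end

/-! ### Identification of the optimal functions across models -/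

namespace GPD

/-- The transform of `ψ` is optimal in the second model, and optimal functions there are unique. -/
theorem isMBRE_ae_eq_push {e : ℝ ≃ᵐ ℝ} {δ s r : ℝ} {P P' : Measure ℝ} {L L' : ℝ → Vec}
    (h : Transfer e δ P P' L L') (hP : Regular P L) (hs : 0 < s) (hr : 0 < r)
    {ψ ψ' : ℝ → Vec} (hψ : IsMBRE P L s r ψ) (hψ' : IsMBRE P' L' (s * δ) r ψ') :
    ∀ᵐ x ∂P', ψ' x = dMat δ *ᵥ ψ (e.symm x) :=
  (uniqueOfForm_isMBRE (h.regular hP) (mul_pos hs h.pos) hr).unique _ _ hψ' (h.isMBRE hs.ne' hψ)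

theorem isOMSE_ae_eq_push {e : ℝ ≃ᵐ ℝ} {δ s r : ℝ} {P P' : Measure ℝ} {L L' : ℝ → Vec}
    (h : Transfer e δ P P' L L') (hP : Regular P L) (hs : 0 < s) (hr : 0 < r)
    {ψ ψ' : ℝ → Vec} (hψ : IsOMSE P L s r ψ) (hψ' : IsOMSE P' L' (s * δ) r ψ') :
    ∀ᵐ x ∂P', ψ' x = dMat δ *ᵥ ψ (e.symm x) :=
  (uniqueOfForm_isOMSE (h.regular hP) (mul_pos hs h.pos) hr).unique _ _ hψ' (h.isOMSE hs.ne' hψ)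

/-- Passing from the log-scale model at `(ξ, 0)` to the one at `(ξ, log β)`. -/
theorem transfer_log_scale (ξ : ℝ) {β : ℝ} (hβ : 0 < β) :
    ∃ e : ℝ ≃ᵐ ℝ, (∀ x, e.symm x = x / β) ∧
      Transfer e 1 (gpdLog ξ 0) (gpdLog ξ (Real.log β)) (scoreLog ξ 0)
        (scoreLog ξ (Real.log β)) := by
  have h1 := (transfer_log ξ one_pos).symm
  -- The parameter factors `1`, `β` and `β⁻¹` multiply to `1`, so multipliers are unchanged and only
  -- the map `x ↦ βx` remains.
  have h := (h1.trans (transfer_scale ξ hβ)).trans (transfer_log ξ hβ)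
  rw [Real.log_one, inv_one, inv_one, one_mul, mul_inv_cancel₀ hβ.ne'] at h
  refine ⟨_, fun x => ?_, h⟩
  exact (div_eq_inv_mul x β).symm

end GPD

theorem proposition3p3 (ξ β r : ℝ) (hξ : -1 / 2 < ξ) (hβ : 0 < β) (hr : 0 < r) :
    -- (a) optimal influence functions in the original model, norm `n_β`
    (GPD.UniqueOfForm (GPD.gpd ξ β)
        (GPD.IsMBRE (GPD.gpd ξ β) (GPD.score ξ β) β r)
        (GPD.IsMBREMult (GPD.gpd ξ β) (GPD.score ξ β) β)
        (GPD.mbreForm (GPD.score ξ β) β) ∧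
      GPD.UniqueOfForm (GPD.gpd ξ β)
        (GPD.IsOMSE (GPD.gpd ξ β) (GPD.score ξ β) β r)
        (GPD.IsOMSEMult (GPD.gpd ξ β) (GPD.score ξ β) β r)
        (GPD.omseForm (GPD.score ξ β) β)) ∧
    -- (b) scale equivariance in the original model
    ((∀ ψ ψ₁ : ℝ → GPD.Vec,
        (GPD.IsMBRE (GPD.gpd ξ β) (GPD.score ξ β) β r ψ ∧
            GPD.IsMBRE (GPD.gpd ξ 1) (GPD.score ξ 1) 1 r ψ₁ ∨
          GPD.IsOMSE (GPD.gpd ξ β) (GPD.score ξ β) β r ψ ∧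
            GPD.IsOMSE (GPD.gpd ξ 1) (GPD.score ξ 1) 1 r ψ₁) →
        ∀ᵐ x ∂(GPD.gpd ξ β), ψ x = (GPD.dMat β).mulVec (ψ₁ (x / β))) ∧
      (∀ (A₁ : GPD.Mat) (a₁ : GPD.Vec) (b₁ : ℝ),
        (GPD.IsMBREMult (GPD.gpd ξ 1) (GPD.score ξ 1) 1 A₁ a₁ b₁ ↔
          GPD.IsMBREMult (GPD.gpd ξ β) (GPD.score ξ β) β
            (GPD.dMat β * A₁ * GPD.dMat β) ((GPD.dMat β).mulVec a₁) b₁) ∧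
        (GPD.IsOMSEMult (GPD.gpd ξ 1) (GPD.score ξ 1) 1 r A₁ a₁ b₁ ↔
          GPD.IsOMSEMult (GPD.gpd ξ β) (GPD.score ξ β) β r
            (GPD.dMat β * A₁ * GPD.dMat β) ((GPD.dMat β).mulVec a₁) b₁)) ∧
      (∀ (A A₁ : GPD.Mat) (a a₁ : GPD.Vec) (b b₁ : ℝ),
        (GPD.IsMBREMult (GPD.gpd ξ β) (GPD.score ξ β) β A a b ∧
            GPD.IsMBREMult (GPD.gpd ξ 1) (GPD.score ξ 1) 1 A₁ a₁ b₁ ∨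
          GPD.IsOMSEMult (GPD.gpd ξ β) (GPD.score ξ β) β r A a b ∧
            GPD.IsOMSEMult (GPD.gpd ξ 1) (GPD.score ξ 1) 1 r A₁ a₁ b₁) →
        b = b₁)) ∧
    -- (c) the log-scale model with the Euclidean norm `n_1`, log-scale parameter `log β`
    ((GPD.UniqueOfForm (GPD.gpdLog ξ (Real.log β))
          (GPD.IsMBRE (GPD.gpdLog ξ (Real.log β)) (GPD.scoreLog ξ (Real.log β)) 1 r)
          (GPD.IsMBREMult (GPD.gpdLog ξ (Real.log β)) (GPD.scoreLog ξ (Real.log β)) 1)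
          (GPD.mbreForm (GPD.scoreLog ξ (Real.log β)) 1) ∧
        GPD.UniqueOfForm (GPD.gpdLog ξ (Real.log β))
          (GPD.IsOMSE (GPD.gpdLog ξ (Real.log β)) (GPD.scoreLog ξ (Real.log β)) 1 r)
          (GPD.IsOMSEMult (GPD.gpdLog ξ (Real.log β)) (GPD.scoreLog ξ (Real.log β)) 1 r)
          (GPD.omseForm (GPD.scoreLog ξ (Real.log β)) 1)) ∧
      (∀ (A : GPD.Mat) (a : GPD.Vec) (b : ℝ),
        (GPD.IsMBREMult (GPD.gpdLog ξ (Real.log β)) (GPD.scoreLog ξ (Real.log β)) 1 A a b ↔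
          GPD.IsMBREMult (GPD.gpdLog ξ 0) (GPD.scoreLog ξ 0) 1 A a b) ∧
        (GPD.IsOMSEMult (GPD.gpdLog ξ (Real.log β)) (GPD.scoreLog ξ (Real.log β)) 1 r A a b ↔
          GPD.IsOMSEMult (GPD.gpdLog ξ 0) (GPD.scoreLog ξ 0) 1 r A a b)) ∧
      (∀ η η₀ : ℝ → GPD.Vec,
        (GPD.IsMBRE (GPD.gpdLog ξ (Real.log β)) (GPD.scoreLog ξ (Real.log β)) 1 r η ∧
            GPD.IsMBRE (GPD.gpdLog ξ 0) (GPD.scoreLog ξ 0) 1 r η₀ ∨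
          GPD.IsOMSE (GPD.gpdLog ξ (Real.log β)) (GPD.scoreLog ξ (Real.log β)) 1 r η ∧
            GPD.IsOMSE (GPD.gpdLog ξ 0) (GPD.scoreLog ξ 0) 1 r η₀) →
        ∀ᵐ x ∂(GPD.gpdLog ξ (Real.log β)), η x = η₀ (x / β))) ∧
    -- (d) relation between the log-scale model and the original model
    ((∀ η ψ : ℝ → GPD.Vec,
        (GPD.IsMBRE (GPD.gpdLog ξ (Real.log β)) (GPD.scoreLog ξ (Real.log β)) 1 r η ∧
            GPD.IsMBRE (GPD.gpd ξ β) (GPD.score ξ β) β r ψ ∨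
          GPD.IsOMSE (GPD.gpdLog ξ (Real.log β)) (GPD.scoreLog ξ (Real.log β)) 1 r η ∧
            GPD.IsOMSE (GPD.gpd ξ β) (GPD.score ξ β) β r ψ) →
        ∀ᵐ x ∂(GPD.gpd ξ β), η x = ((GPD.dMat β)⁻¹).mulVec (ψ x)) ∧
      (∀ (A : GPD.Mat) (a : GPD.Vec) (b : ℝ),
        (GPD.IsMBREMult (GPD.gpd ξ β) (GPD.score ξ β) β A a b ↔
          GPD.IsMBREMult (GPD.gpdLog ξ (Real.log β)) (GPD.scoreLog ξ (Real.log β)) 1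
            ((GPD.dMat β)⁻¹ * A * (GPD.dMat β)⁻¹) (((GPD.dMat β)⁻¹).mulVec a) b) ∧
        (GPD.IsOMSEMult (GPD.gpd ξ β) (GPD.score ξ β) β r A a b ↔
          GPD.IsOMSEMult (GPD.gpdLog ξ (Real.log β)) (GPD.scoreLog ξ (Real.log β)) 1 r
            ((GPD.dMat β)⁻¹ * A * (GPD.dMat β)⁻¹) (((GPD.dMat β)⁻¹).mulVec a) b))) := by
  have hR := GPD.regular_gpd hξ hβ
  have hR₁ := GPD.regular_gpd hξ one_pos
  have hRl := GPD.regular_gpdLog hξ hβ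
  have hT := GPD.transfer_scale ξ hβ
  have hL := GPD.transfer_log ξ hβ
  obtain ⟨e, he, hE⟩ := GPD.transfer_log_scale ξ hβ
  have hR₀ : GPD.Regular (GPD.gpdLog ξ 0) (GPD.scoreLog ξ 0) := hE.symm.regular hRl
  have hββ : β * β⁻¹ = 1 := mul_inv_cancel₀ hβ.ne'
  have hM₁ : ∀ (A₁ : GPD.Mat) (a₁ : GPD.Vec) (b₁ : ℝ),
      GPD.IsMBREMult (GPD.gpd ξ 1) (GPD.score ξ 1) 1 A₁ a₁ b₁ ↔
        GPD.IsMBREMult (GPD.gpd ξ β) (GPD.score ξ β) β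
          (GPD.dMat β * A₁ * GPD.dMat β) ((GPD.dMat β).mulVec a₁) b₁ := fun A₁ a₁ b₁ => by
    simpa only [one_mul] using hT.isMBREMult_iff one_ne_zero
  have hO₁ : ∀ (A₁ : GPD.Mat) (a₁ : GPD.Vec) (b₁ : ℝ),
      GPD.IsOMSEMult (GPD.gpd ξ 1) (GPD.score ξ 1) 1 r A₁ a₁ b₁ ↔
        GPD.IsOMSEMult (GPD.gpd ξ β) (GPD.score ξ β) β r
          (GPD.dMat β * A₁ * GPD.dMat β) ((GPD.dMat β).mulVec a₁) b₁ := fun A₁ a₁ b₁ => by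
    simpa only [one_mul] using hT.isOMSEMult_iff one_ne_zero
  refine ⟨⟨GPD.uniqueOfForm_isMBRE hR hβ hr, GPD.uniqueOfForm_isOMSE hR hβ hr⟩,
    ⟨?_, fun A₁ a₁ b₁ => ⟨hM₁ A₁ a₁ b₁, hO₁ A₁ a₁ b₁⟩, ?_⟩,
    ⟨⟨GPD.uniqueOfForm_isMBRE hRl one_pos hr, GPD.uniqueOfForm_isOMSE hRl one_pos hr⟩,
      fun A a b => ⟨?_, ?_⟩, ?_⟩, ?_, fun A a b => ⟨?_, ?_⟩⟩
  · have hsymm : ∀ x, (MeasurableEquiv.mulLeft₀ β hβ.ne').symm x = x / β :=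
      fun x => (div_eq_inv_mul x β).symm
    simp_rw [← hsymm]
    rintro ψ ψ₁ (⟨h, h₁⟩ | ⟨h, h₁⟩)
    · exact GPD.isMBRE_ae_eq_push hT hR₁ one_pos hr h₁ (by rwa [one_mul])
    · exact GPD.isOMSE_ae_eq_push hT hR₁ one_pos hr h₁ (by rwa [one_mul])
  · rintro A A₁ a a₁ b b₁ (⟨h, h₁⟩ | ⟨h, h₁⟩)
    · exact h.eq_bound ((hM₁ A₁ a₁ b₁).1 h₁)
    · exact h.eq_bound hR hβ hr ((hO₁ A₁ a₁ b₁).1 h₁)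
  · have := hE.isMBREMult_iff one_ne_zero (A := A) (a := a) (b := b)
    rw [GPD.dMat_one, Matrix.one_mul, Matrix.mul_one, Matrix.one_mulVec, mul_one] at this
    exact this.symm
  · have := hE.isOMSEMult_iff (r := r) one_ne_zero (A := A) (a := a) (b := b)
    rw [GPD.dMat_one, Matrix.one_mul, Matrix.mul_one, Matrix.one_mulVec, mul_one] at this
    exact this.symm
  · simp_rw [← he]
    rintro η η₀ (⟨h, h₀⟩ | ⟨h, h₀⟩)
    · have := GPD.isMBRE_ae_eq_push hE hR₀ one_pos hr h₀ (by rwa [one_mul])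
      simpa only [GPD.dMat_one, Matrix.one_mulVec] using this
    · have := GPD.isOMSE_ae_eq_push hE hR₀ one_pos hr h₀ (by rwa [one_mul])
      simpa only [GPD.dMat_one, Matrix.one_mulVec] using this
  · have hlog : GPD.gpdLog ξ (Real.log β) = GPD.gpd ξ β := by rw [GPD.gpdLog, Real.exp_log hβ]
    rw [GPD.dMat_inv_eq hβ.ne']
    rintro η ψ (⟨h, h₁⟩ | ⟨h, h₁⟩)
    · have := GPD.isMBRE_ae_eq_push hL hR hβ hr h₁ (by rwa [hββ])
      rwa [hlog] at this
    · have := GPD.isOMSE_ae_eq_push hL hR hβ hr h₁ (by rwa [hββ])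
      rwa [hlog] at this
  · have := hL.isMBREMult_iff hβ.ne' (A := A) (a := a) (b := b)
    rwa [hββ, ← GPD.dMat_inv_eq hβ.ne'] at this
  · have := hL.isOMSEMult_iff (r := r) hβ.ne' (A := A) (a := a) (b := b)
    rwa [hββ, ← GPD.dMat_inv_eq hβ.ne'] at this
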